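/- Fix $r$ and an $r$-dimensional complex vector space $U$ with basis $E_1,\dots,E_r$, and identify $\bigwedge^r U\cong\mathbb C$ by $E_1\wedge\cdots\wedge E_r\mapsto 1$. For $S\subseteq[r]$ let $E_S\in\bigwedge^{|S|}U$ be the wedge of the $E_i$, $i\in S$, in ascending order. Let $G$ be a finite planar bipartite graph in the disk (parallel edges allowed) whose boundary vertices $1,\dots,n$, in counterclockwise order, are black and each incident to at most one edge. An *$r$-weblike subgraph* $W$ of $G$ is a subgraph on all vertices of $G$ with a multiplicity $m(e)\in\{1,\dots,r\}$ on each of its edges such that the multiplicities around each interior vertex sum to $r$. Let $\lambda_i$ be the multiplicity of the edge of $W$ at boundary vertex $i$ ($0$ if there is none), and let $k$ be the number of white vertices minus the number of interior black vertices. A *tagging* $\mathcal O$ of $W$ gives each edge either a direction, or a pair tag (both halves directed towards the tag), or a source tag (both halves directed away from the tag), each tag lying on a chosen side of its edge. A (half-)edge directed from black to white carries $\bigwedge^{m(e)}U$ and one directed from white to black carries $\bigwedge^{r-m(e)}U$. It is required that each white vertex has exactly one outgoing half-edge, each interior black vertex has exactly one incoming half-edge, the half-edges at the boundary are directed away from the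 boundary, and there are no oriented cycles. The resulting tagged web $\hat W=\hat W(W,\mathcal O)$ is a functional on $\bigotimes_{i=1}^n\bigwedge^{\lambda_i}U$: place $x_i$ at boundary vertex $i$ and compose, along the arrows, the following maps. * At a white vertex, $x_1\otimes\cdots\otimes x_s\mapsto x_1\wedge\cdots\wedge x_s$, with the incoming edges taken from left to right when the outgoing edge points up. * At an interior black vertex, whose outgoing edges have multiplicities $a_1,\dots,a_s$ from left to right when the incoming edge comes from below, the shuffle map $\bigwedge^{b}U\to\bigwedge^{a_s}U\otimes\cdots\otimes\bigwedge^{a_1}U$, $b=a_1+\cdots+a_s$. It sends $x_1\wedge\cdots\wedge x_b$ to the sum, over the permutations $(i_1,\dots,i_b)$ that are increasing in each of the consecutive blocks of sizes $a_s,\dots,a_1$, of the tensor products of the corresponding wedges; the sign is that of $(i_1,\dots,i_b)$ times $(-1)^{\sum_{i<j}a_ia_j}$. * At a pair tag, the wedge of the two incoming tensors in $\bigwedge^rU\cong\mathbb C$, the left one first when the tag points north. * At a source tag, the shuffle of $E_1\wedge\cdots\wedge E_r$ into the two halves of the edge, the first factor on the left half when the tag points north. A *consistent labeling* of $W$ assigns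 to each edge $e$ of $W$ a subset $S(e)\subseteq[r]$ with $|S(e)|=m(e)$ such that the union of the subsets around each interior vertex is $[r]$. A *list of boundary label subsets* is $\mathcal S=(S_1,\dots,S_n)$ with $S_i\subseteq[r]$ and $|S_i|=\lambda_i$, such that each element of $[r]$ lies in exactly $k$ of the $S_i$. Put $E_{\mathcal S}=E_{S_1}\otimes\cdots\otimes E_{S_n}$. Let $\mathrm{sign}(\mathcal S)$ be $(-1)$ to the number of inversions of the word obtained by writing $S_1,\dots,S_n$ one after the other, each in ascending order. Let $a(\mathcal S;W)$ be the number of consistent labelings of $W$ whose label on the edge at each boundary vertex $i$ is $S_i$. **Lemma.** Let $W$ be an $r$-weblike subgraph of $G$ and $\hat W=\hat W(W,\mathcal O)$ a tagging of $W$. There is a sign $\mathrm{sign}(W,\mathcal O)\in\{\pm1\}$ such that, for every list of boundary label subsets $\mathcal S$, $$\hat W\big|_{E_{\mathcal S}}=\mathrm{sign}(\mathcal S)\,\mathrm{sign}(W,\mathcal O)\,a(\mathcal S;W).$$ -/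

import Mathlib

open scoped BigOperators

/-! ## Planar bipartite graphs in the disk -/

/-- Number of cycles of a permutation of a finite set, fixed points included. -/
noncomputable def permCycleCount {α : Type*} (σ : Equiv.Perm α) : ℕ :=
  Nat.card (Quotient (Equiv.Perm.SameCycle.setoid σ))

/-- A bipartite graph (parallel edges allowed) drawn on an oriented surface with one boundary
circle, given by its rotation system. `Wh`: white vertices (all interior), `Bl`: interior black
vertices, `Fin n`: the boundary vertices, which are black, listed in counterclockwise order, each
incident to at most one edge. `rotWhite` (resp. `rotBlack`) sends an edge to the next edge in
counterclockwise order around its white (resp. black) endpoint. -/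
structure DiskMap (n : ℕ) (Wh Bl Ed : Type*) where
  white : Ed → Wh
  black : Ed → Bl ⊕ Fin n
  boundary_unique : ∀ e f i, black e = Sum.inr i → black f = Sum.inr i → e = f
  rotWhite : Equiv.Perm Ed
  rotBlack : Equiv.Perm Ed
  sameCycle_rotWhite : ∀ e f, rotWhite.SameCycle e f ↔ white e = white f
  sameCycle_rotBlack : ∀ e f, rotBlack.SameCycle e f ↔ black e = black f

namespace DiskMap

variable {n : ℕ} {Wh Bl Ed : Type*} [Fintype Ed] [DecidableEq Wh] [DecidableEq Bl]
  [DecidableEq Ed]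

/-- The boundary edges `b₁, b₂, …` in counterclockwise order (boundary vertices without an edge
are skipped). -/
noncomputable def boundaryEdges (G : DiskMap n Wh Bl Ed) : List Ed :=
  (List.finRange n).flatMap fun i => (Finset.univ.filter fun e => G.black e = Sum.inr i).toList

/-- Collapse the boundary circle of the surface to a point, so that all boundary vertices become
one black vertex. Seen from that vertex the boundary edges occur in the order `…, b₂, b₁` when one
turns counterclockwise. This is the resulting rotation at the black vertices. (`rotBlack` fixes
the boundary edges, and the inverse of the cycle `(b₁ b₂ …)` fixes all the other edges.) -/
noncomputable def collapsedRotBlack (G : DiskMap n Wh Bl Ed) : Equiv.Perm Ed :=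
  G.rotBlack * (G.boundaryEdges.formPerm)⁻¹

/-- The drawing is planar, i.e. it is a drawing in the disk: after collapsing the boundary circle
to a point, every connected component is drawn on a sphere. This is Euler's formula `V - E + F = 2`
summed over the components: white vertices, black vertices and faces are the cycles of
the two rotations and of their product, and the components are the orbits of the group
generated by the rotations. -/
def Planar (G : DiskMap n Wh Bl Ed) : Prop :=
  permCycleCount G.rotWhite + permCycleCount G.collapsedRotBlack
      + permCycleCount (G.rotWhite * G.collapsedRotBlack)
    = Fintype.card Ed
      + 2 * Nat.card (MulAction.orbitRel.Quotient
          (Subgroup.closure {G.rotWhite, G.collapsedRotBlack}) Ed)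

/-! ## Weblike subgraphs and consistent labelings -/

/-- An `r`-weblike subgraph: a subgraph on all the vertices whose edges carry multiplicities in
`{1, …, r}` that sum to `r` around each interior vertex. Multiplicity `0` means that the
edge does not belong to the subgraph. -/
structure Weblike (G : DiskMap n Wh Bl Ed) (r : ℕ) where
  mult : Ed → ℕ
  mult_le : ∀ e, mult e ≤ r
  sum_white : ∀ w : Wh, ∑ e with G.white e = w, mult e = r
  sum_black : ∀ b : Bl, ∑ e with G.black e = Sum.inl b, mult e = r

namespace Weblike

variable {G : DiskMap n Wh Bl Ed} {r : ℕ}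

/-- The degree `λ(W)`: the multiplicities of the boundary edges (`0` if there is no edge). -/
def degree (W : G.Weblike r) (i : Fin n) : ℕ :=
  ∑ e with G.black e = Sum.inr i, W.mult e

/-- Consistent labelings of `W` by subsets of `[r]`. (Edges that are not in `W` necessarily get the
empty label.) -/
structure IsConsistent (W : G.Weblike r) (ℓ : Ed → Finset (Fin r)) : Prop where
  card_eq : ∀ e, (ℓ e).card = W.mult e
  union_white : ∀ w : Wh, (Finset.univ.filter fun e => G.white e = w).biUnion ℓ = Finset.univ
  union_black : ∀ b : Bl,
    (Finset.univ.filter fun e => G.black e = Sum.inl b).biUnion ℓ = Finset.univ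

/-- `a(S; W)`: the number of consistent labelings with boundary label subsets `S`. -/
noncomputable def labelingCount (W : G.Weblike r) (S : Fin n → Finset (Fin r)) : ℕ :=
  Nat.card {ℓ : Ed → Finset (Fin r) //
    W.IsConsistent ℓ ∧ ∀ e i, G.black e = Sum.inr i → ℓ e = S i}

/-- Lists of boundary label subsets `S = (S₁, …, Sₙ)` for `W`: the set `S_i` has size `λ_i`, and
each element of `[r]` belongs to exactly `k` of them, `k` being the excedance of the graph, that is
the number of white vertices minus the number of interior black vertices. -/
structure IsBoundaryLabels [Fintype Wh] [Fintype Bl] (W : G.Weblike r)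
    (S : Fin n → Finset (Fin r)) : Prop where
  card_eq : ∀ i, (S i).card = W.degree i
  balanced : ∀ c : Fin r, ((Finset.univ.filter fun i => c ∈ S i).card : ℤ)
    = (Fintype.card Wh : ℤ) - (Fintype.card Bl : ℤ)

end Weblike

end DiskMap

/-! ## Signs of words -/

/-- The number of inversions of a word. -/
def inversions {r : ℕ} : List (Fin r) → ℕ
  | [] => 0
  | a :: l => l.countP (fun b => b < a) + inversions l

/-- The word obtained by writing the given sets one after the other, each in ascending order. -/
def blockWord {r : ℕ} (l : List (Finset (Fin r))) : List (Fin r) :=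
  l.flatMap fun S => S.sort

/-- `sign(S)`: the parity of the number of inversions of the word of `S₁, …, Sₙ`. -/
def labelSign {n r : ℕ} (S : Fin n → Finset (Fin r)) : ℤˣ :=
  (-1) ^ inversions (blockWord (List.ofFn S))

/-- The sum of `aᵢ aⱼ` over all pairs of positions `i < j`. -/
def pairProductSum : List ℕ → ℕ
  | [] => 0
  | a :: l => a * l.sum + pairProductSum l

/-- The coefficient of `E_{B₁} ⊗ ⋯ ⊗ E_{Bₛ}` in the shuffle of `E_S`: zero unless the blocks `Bᵢ`
partition `S`; otherwise the sign of the permutation that lists the elements of `S` block by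
block, times the sign of the permutation that reverses the order of the blocks. -/
def shuffleCoeff {r : ℕ} (S : Finset (Fin r)) (blocks : List (Finset (Fin r))) : ℤ :=
  if (blockWord blocks).Perm S.sort then
    (-1) ^ inversions (blockWord blocks) * (-1) ^ pairProductSum (blocks.map Finset.card)
  else 0

/-! ## Taggings -/

/-- The decoration of an edge: it is directed towards its white or its black endpoint, or it
carries a pair tag (both halves directed towards the tag) or a source tag (both halves directed
away from the tag). A tag sits on one of the two sides of the edge: `blackFirst` is `true` when
the half at the black endpoint is the left one as the tag points north. -/
inductive EdgeKind
  | toWhite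
  | toBlack
  | pair (blackFirst : Bool)
  | source (blackFirst : Bool)

namespace EdgeKind

/-- The half-edge at the white endpoint is directed away from that endpoint. -/
def LeavesWhite : EdgeKind → Prop
  | toBlack => True
  | pair _ => True
  | _ => False

/-- The half-edge at the black endpoint is directed towards that endpoint. -/
def EntersBlack : EdgeKind → Prop
  | toBlack => True
  | source _ => True
  | _ => False

/-- The edge carries a tag. -/
def Tagged : EdgeKind → Prop
  | pair _ => True
  | source _ => True
  | _ => False

end EdgeKind

/-- The direction of a half-edge, or of an untagged edge. -/
inductive Heading
  | toWhite
  | toBlack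
deriving DecidableEq

/-- The four basic morphisms sit at the interior vertices and at the tags. -/
inductive WebPiece (Wh Bl Ed : Type*)
  | white (w : Wh)
  | black (b : Bl)
  | tag (e : Ed)

namespace DiskMap.Weblike

variable {n r : ℕ} {Wh Bl Ed : Type*} [Fintype Ed] [DecidableEq Wh] [DecidableEq Bl]
  [DecidableEq Ed] {G : DiskMap n Wh Bl Ed}

/-- `W.Arrow kind p q`: some edge or half-edge of `W`, decorated by `kind`, is directed from the
vertex or tag `p` to the vertex or tag `q`. -/
inductive Arrow (W : G.Weblike r) (kind : Ed → EdgeKind) :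
    WebPiece Wh Bl Ed → WebPiece Wh Bl Ed → Prop
  | toWhite (e : Ed) (b : Bl) : 0 < W.mult e → kind e = .toWhite → G.black e = Sum.inl b →
      Arrow W kind (.black b) (.white (G.white e))
  | toBlack (e : Ed) (b : Bl) : 0 < W.mult e → kind e = .toBlack → G.black e = Sum.inl b →
      Arrow W kind (.white (G.white e)) (.black b)
  | pairWhite (e : Ed) (s : Bool) : 0 < W.mult e → kind e = .pair s →
      Arrow W kind (.white (G.white e)) (.tag e)
  | pairBlack (e : Ed) (s : Bool) (b : Bl) : 0 < W.mult e → kind e = .pair s →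
      G.black e = Sum.inl b → Arrow W kind (.black b) (.tag e)
  | sourceWhite (e : Ed) (s : Bool) : 0 < W.mult e → kind e = .source s →
      Arrow W kind (.tag e) (.white (G.white e))
  | sourceBlack (e : Ed) (s : Bool) (b : Bl) : 0 < W.mult e → kind e = .source s →
      G.black e = Sum.inl b → Arrow W kind (.tag e) (.black b)

/-- A tagging `O` of `W`: every edge is decorated (decorations of edges outside `W` are
irrelevant) in such a way that every white vertex is a wedge vertex (exactly one outgoing half-edge,
`whiteOut`), every interior black vertex is a shuffle vertex (exactly one incoming half-edge,
`blackIn`), the half-edges at the boundary are directed away from the boundary, and there are no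
oriented cycles.

A half-edge directed from black to white has multiplicity `m(e)`, one directed from
white to black has multiplicity `r - m(e)`. As the `m(e)` around a vertex sum to `r`, a white
vertex conserves multiplicity exactly when it has one outgoing half-edge, and an interior black
vertex exactly when it has one incoming half-edge, so these are all the possibilities. -/
structure Tagging (W : G.Weblike r) where
  kind : Ed → EdgeKind
  whiteOut : Wh → Ed
  white_whiteOut : ∀ w, G.white (whiteOut w) = w
  mult_whiteOut : ∀ w, 0 < W.mult (whiteOut w)
  leavesWhite_iff : ∀ e, 0 < W.mult e → ((kind e).LeavesWhite ↔ e = whiteOut (G.white e))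
  blackIn : Bl → Ed
  black_blackIn : ∀ b, G.black (blackIn b) = Sum.inl b
  mult_blackIn : ∀ b, 0 < W.mult (blackIn b)
  entersBlack_iff : ∀ e b, 0 < W.mult e → G.black e = Sum.inl b →
    ((kind e).EntersBlack ↔ e = blackIn b)
  boundary_source : ∀ e i, 0 < W.mult e → G.black e = Sum.inr i → ¬ (kind e).EntersBlack
  acyclic : ∀ p, ¬ Relation.TransGen (W.Arrow kind) p p

/-- The other edges of `W` at the vertex with rotation `σ`, in counterclockwise order starting
after `e`. -/
noncomputable def edgesAfter (W : G.Weblike r) (σ : Equiv.Perm Ed) (e : Ed) : List Ed :=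
  (List.iterate σ (σ e) (Function.minimalPeriod σ e - 1)).filter fun f => 0 < W.mult f

/-- The multiplicity of a directed half-edge. -/
def arcMult (W : G.Weblike r) : Ed × Heading → ℕ
  | (e, .toWhite) => W.mult e
  | (e, .toBlack) => r - W.mult e

namespace Tagging

variable {W : G.Weblike r}

/-- An order in which the basic morphisms can be composed: all the vertices and tags of the tagged
web, each once, every arrow going from an earlier to a later one. -/
structure IsSchedule (T : W.Tagging) (L : List (WebPiece Wh Bl Ed)) : Prop where
  nodup : L.Nodup
  white_mem : ∀ w, WebPiece.white w ∈ L
  black_mem : ∀ b, WebPiece.black b ∈ L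
  tag_mem : ∀ e, WebPiece.tag e ∈ L ↔ 0 < W.mult e ∧ (T.kind e).Tagged
  pairwise : L.Pairwise fun p q => ¬ W.Arrow T.kind q p

/-- As a tagged web has no oriented cycles, such an order exists. -/
theorem exists_isSchedule [Finite Wh] [Finite Bl] (T : W.Tagging) : ∃ L, T.IsSchedule L := by
  classical
  have hfin : Finite (WebPiece Wh Bl Ed) := by
    let f : WebPiece Wh Bl Ed → Wh ⊕ Bl ⊕ Ed := fun p => match p with
      | .white w => .inl w
      | .black b => .inr (.inl b)
      | .tag e => .inr (.inr e)
    refine Finite.of_injective f ?_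
    rintro (w | b | e) (w' | b' | e') h <;> simp_all [f]
  have := Fintype.ofFinite (WebPiece Wh Bl Ed)
  have hpo : IsPartialOrder (WebPiece Wh Bl Ed) (Relation.ReflTransGen (W.Arrow T.kind)) :=
    { refl := fun _ => .refl
      trans := fun _ _ _ => .trans
      antisymm := by
        intro a b hab hba
        rcases Relation.reflTransGen_iff_eq_or_transGen.1 hab with h | h
        · exact h.symm
        · exact (T.acyclic a (h.trans_left hba)).elim }
  obtain ⟨s, hs, hle⟩ := extend_partialOrder (Relation.ReflTransGen (W.Arrow T.kind))
  let A : Finset (WebPiece Wh Bl Ed) := Finset.univ.filter fun p =>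
    match p with
    | .white _ => True
    | .black _ => True
    | .tag e => 0 < W.mult e ∧ (T.kind e).Tagged
  refine ⟨A.sort s, Finset.sort_nodup _ _, ?_, ?_, ?_, ?_⟩
  · intro w; simp [A]
  · intro b; simp [A]
  · intro e; simp [A]
  · have h1 : (A.sort s).Pairwise s := Finset.pairwise_sort _ _
    have h2 : (A.sort s).Nodup := Finset.sort_nodup _ _
    refine (h1.and h2).imp ?_
    rintro p q ⟨hpq, hne⟩ harr
    exact hne (antisymm_of s hpq (hle _ _ (.single harr)))

/-! ## Evaluation of a tagged web -/

section Evaluation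

variable {U : Type*} [AddCommGroup U] [Module ℂ U]

/-- Apply the shuffle map to `y`, place the tensor factors on the half-edges `outs` (in this order,
with the prescribed multiplicities), and continue with the remaining evaluation `k`. Here
`E.ExteriorAlgebra S` is `E_S`, the wedge of the basis vectors in `S` in ascending order, and `y` is
expanded in the basis of the `E_S`. -/
noncomputable def shuffleThen (W : G.Weblike r) (E : Module.Basis (Fin r) ℂ U)
    (outs : List (Ed × Heading)) (y : ExteriorAlgebra ℂ U)
    (k : (Ed × Heading → ExteriorAlgebra ℂ U) → ℂ)
    (x : Ed × Heading → ExteriorAlgebra ℂ U) : ℂ :=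
  ∑ S : Finset (Fin r), E.ExteriorAlgebra.repr y S *
    ∑ B : {a // a ∈ outs} → Finset (Fin r),
      if ∀ a, (B a).card = W.arcMult a.1 then
        (shuffleCoeff S (outs.attach.map B) : ℂ) *
          k fun a => if h : a ∈ outs then E.ExteriorAlgebra (B ⟨a, h⟩) else x a
      else 0

/-- Identification of the top exterior power with `ℂ` by the volume form `E_1 ∧ ⋯ ∧ E_r`. -/
noncomputable def volCoeff (E : Module.Basis (Fin r) ℂ U) (y : ExteriorAlgebra ℂ U) : ℂ :=
  E.ExteriorAlgebra.repr y Finset.univ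

/-- Apply the morphism of one vertex or tag to the tensors `x` placed on the half-edges, and
continue with the remaining evaluation `k`.
* White vertex: the incoming tensors are wedged, in counterclockwise order starting after the
  outgoing half-edge (from left to right when the outgoing half-edge points up).
* Black vertex: the incoming tensor is shuffled into the outgoing half-edges, the factors being
  placed in counterclockwise order starting after the incoming half-edge (from right to left
  when the incoming half-edge comes from below).
* Pair tag: the two tensors are wedged, left one first as the tag points north.
* Source tag: the volume form is shuffled into the two halves of the edge. -/
noncomputable def step (T : W.Tagging) (E : Module.Basis (Fin r) ℂ U) :
    WebPiece Wh Bl Ed → ((Ed × Heading → ExteriorAlgebra ℂ U) → ℂ) →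
      (Ed × Heading → ExteriorAlgebra ℂ U) → ℂ
  | .white w, k, x =>
      k (Function.update x (T.whiteOut w, .toBlack)
        ((W.edgesAfter G.rotWhite (T.whiteOut w)).map fun f => x (f, .toWhite)).prod)
  | .black b, k, x =>
      shuffleThen W E ((W.edgesAfter G.rotBlack (T.blackIn b)).map fun f => (f, .toWhite))
        (x (T.blackIn b, .toBlack)) k x
  | .tag e, k, x =>
      match T.kind e with
      | .pair true => volCoeff E (x (e, .toWhite) * x (e, .toBlack)) * k x
      | .pair false => volCoeff E (x (e, .toBlack) * x (e, .toWhite)) * k x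
      | .source true =>
          shuffleThen W E [(e, .toBlack), (e, .toWhite)] (E.ExteriorAlgebra Finset.univ) k x
      | .source false =>
          shuffleThen W E [(e, .toWhite), (e, .toBlack)] (E.ExteriorAlgebra Finset.univ) k x
      | .toWhite => k x
      | .toBlack => k x

/-- The tensors `x₁, …, xₙ` placed on the boundary half-edges; nothing is placed elsewhere yet. -/
def initialTensors (G : DiskMap n Wh Bl Ed) (x : Fin n → ExteriorAlgebra ℂ U) :
    Ed × Heading → ExteriorAlgebra ℂ U
  | (e, .toWhite) => match G.black e with
      | .inr i => x i
      | .inl _ => 0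
  | (_, .toBlack) => 0

/-- The value of the tagged web on `x₁ ⊗ ⋯ ⊗ xₙ`: place `x_i` at the boundary vertex `i` and compose
the basic morphisms along the schedule `L`. (A boundary vertex of degree `0` contributes the scalar
`x_i` of degree `0`.) -/
noncomputable def evaluate (T : W.Tagging) (L : List (WebPiece Wh Bl Ed))
    (E : Module.Basis (Fin r) ℂ U) (x : Fin n → ExteriorAlgebra ℂ U) : ℂ :=
  (∏ i with W.degree i = 0, E.ExteriorAlgebra.repr (x i) ∅) *
    L.foldr (T.step E) (fun _ => 1) (initialTensors G x)

end Evaluation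

end Tagging

end DiskMap.Weblike

set_option linter.unusedSectionVars false

/-! ## Chains modulo two and planarity -/

section ChainsModTwo

variable {α : Type*}

/-! Expanding every shuffle in the basis `E_S` writes the value on basis tensors as a sum over
labelings of the half-edges. Each term is a product of matrix entries, one per vertex or tag
(`foldr_represents`). An entry is `±1` if its blocks form the required partition, with the
prescribed sizes at a shuffle, and `0` otherwise. Once labels on half-edges heading to black are
complemented, the nonzero terms are exactly the consistent labelings with the given boundary
(`evaluate_eq_sum`). It remains to show that all terms have the same sign.

The sign at a vertex comes from the word of all labels around it except that of its distinguished
edge (outgoing at white, incoming at black). Appending the missing label `A` adds the inversions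
between the complement of `A` and `A`. A tag contributes the same number, up to a sign fixed by the
multiplicity. An edge directed to white receives no such correction and any other edge of the web
receives exactly two, so the corrections cancel (`prod_corrections`). Up to a factor fixed by the
tagging, the sign is therefore the parity of the inversions of the full words around the interior
vertices. The claim becomes that this parity, together with that of the boundary word, is the same
for all consistent labelings (`inversionParity_congr`).

Here planarity enters. Inversions split over pairs of colours `c < d` into ordered pairings of the
two colour classes around the vertices. The boundary is collapsed to one more black vertex;
reversing its word costs a constant. Every colour class meets each interior vertex once and the
boundary `k` times modulo two, so two classes differ by a cycle modulo two. On a sphere every cycle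
is a coboundary of a function on faces, by an Euler characteristic count (`exists_face_potential`).
Telescoping around the vertices then shows that the pairing of two cycles is the number of their
common edges (`totalPairing_eq_of_planar`). Relative to a fixed base class, the sum over all pairs
of colours thus involves only the sum of the classes and the number of colour pairs on each edge,
and both are determined by the multiplicities (`sum_totalPairing_eq`). -/

theorem perm_apply_inv (σ : Equiv.Perm α) (a : α) : σ (σ⁻¹ a) = a := σ.apply_symm_apply a

theorem perm_inv_apply (σ : Equiv.Perm α) (a : α) : σ⁻¹ (σ a) = a := σ.symm_apply_apply a

/-- The functions that are constant on the classes of an equivalence relation. -/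
def invariantChains (K : Type*) [Semiring K] (s : Setoid α) : Submodule K (α → K) where
  carrier := {x | ∀ a b, s a b → x a = x b}
  add_mem' hx hy a b h := by simp only [Pi.add_apply, hx a b h, hy a b h]
  zero_mem' _ _ _ := rfl
  smul_mem' c x hx a b h := by simp only [Pi.smul_apply, hx a b h]

/-- This turns the vertex, face and component counts of Euler's formula into dimensions. -/
theorem finrank_invariantChains (K : Type*) [Field K] [Finite α] (s : Setoid α) :
    Module.finrank K (invariantChains K s) = Nat.card (Quotient s) := by
  classical
  have : Fintype (Quotient s) := Fintype.ofFinite _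
  let f : (Quotient s → K) ≃ₗ[K] invariantChains K s :=
    { toFun := fun g => ⟨fun a => g ⟦a⟧, fun a b h => congrArg g (Quotient.sound h)⟩
      map_add' := fun _ _ => rfl
      map_smul' := fun _ _ => rfl
      invFun := fun x => Quotient.lift x.1 fun a b h => x.2 a b h
      left_inv := fun g => by
        funext q
        induction q using Quotient.inductionOn
        rfl
      right_inv := fun x => rfl }
  rw [← f.finrank_eq, Module.finrank_fintype_fun_eq_card, Nat.card_eq_fintype_card]

theorem mem_invariantChains_sameCycle {K : Type*} [Semiring K] [Finite α] {σ : Equiv.Perm α}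
    {x : α → K} :
    x ∈ invariantChains K (Equiv.Perm.SameCycle.setoid σ) ↔ ∀ a, x (σ a) = x a := by
  constructor
  · intro h a
    exact (h a (σ a) ⟨1, by simp⟩).symm
  · rintro h a b hab
    obtain ⟨i, -, rfl⟩ := Equiv.Perm.SameCycle.exists_pow_eq' hab
    clear hab
    induction i with
    | zero => rfl
    | succ i ih => rw [pow_succ', Equiv.Perm.mul_apply, h, ih]

theorem mem_invariantChains_orbitRel {K : Type*} [Semiring K] [Finite α] {σ τ : Equiv.Perm α}
    {x : α → K} :
    x ∈ invariantChains K (MulAction.orbitRel (Subgroup.closure {σ, τ}) α) ↔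
      (∀ a, x (σ a) = x a) ∧ ∀ a, x (τ a) = x a := by
  constructor
  · intro h
    constructor <;> intro a <;> refine h _ _ ?_
    · exact ⟨⟨σ, Subgroup.subset_closure (by simp)⟩, rfl⟩
    · exact ⟨⟨τ, Subgroup.subset_closure (by simp)⟩, rfl⟩
  · rintro ⟨h1, h2⟩ a b ⟨⟨g, hg⟩, rfl⟩
    change x (g b) = x b
    induction hg using Subgroup.closure_induction generalizing b with
    | mem y hy =>
      rcases hy with rfl | rfl
      · exact h1 b
      · exact h2 b
    | one => rfl
    | mul y z _ _ hy hz => rw [Equiv.Perm.mul_apply, hy, hz]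
    | inv y _ hy => rw [← hy (y⁻¹ b), perm_apply_inv]

/-- Being constant around all white and all black vertices means being constant on connected
components. Hence the sum of the two spaces has dimension vertices minus components. -/
theorem invariantChains_inf {K : Type*} [Semiring K] [Finite α] (σ τ : Equiv.Perm α) :
    invariantChains K (Equiv.Perm.SameCycle.setoid σ)
        ⊓ invariantChains K (Equiv.Perm.SameCycle.setoid τ)
      = invariantChains K (MulAction.orbitRel (Subgroup.closure {σ, τ}) α) := by
  ext x
  rw [Submodule.mem_inf, mem_invariantChains_sameCycle, mem_invariantChains_sameCycle,
    mem_invariantChains_orbitRel]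

/-- In a planar map every cycle modulo two is a sum of face boundaries. -/
theorem exists_face_potential [Fintype α] {σ τ : Equiv.Perm α}
    (h : permCycleCount σ + permCycleCount τ + permCycleCount (σ * τ) = Fintype.card α
      + 2 * Nat.card (MulAction.orbitRel.Quotient (Subgroup.closure {σ, τ}) α))
    (z : α → ZMod 2) (hσ : ∀ y : α → ZMod 2, (∀ a, y (σ a) = y a) → ∑ a, z a * y a = 0)
    (hτ : ∀ y : α → ZMod 2, (∀ a, y (τ a) = y a) → ∑ a, z a * y a = 0) :
    ∃ p : α → ZMod 2, (∀ a, p (σ (τ a)) = p a) ∧ ∀ a, z a = p a + p (τ⁻¹ a) := by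
  classical
  let K := ZMod 2
  let I := fun s : Setoid α => invariantChains K s
  let S := Equiv.Perm.SameCycle.setoid σ
  let T := Equiv.Perm.SameCycle.setoid τ
  let F := Equiv.Perm.SameCycle.setoid (σ * τ)
  let B : LinearMap.BilinForm K (α → K) := dotProductBilin K K
  have hB : ∀ x y, B x y = ∑ a, x a * y a := fun x y => rfl
  have hcomm : ∀ x y, B x y = B y x := fun x y => by simp only [hB, mul_comm]
  have hnd : B.Nondegenerate := by
    have : ∀ x, (∀ y, B x y = 0) → x = 0 := by
      intro x hx
      funext a
      simpa [hB, Pi.single_apply] using hx (Pi.single a 1)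
    exact ⟨this, fun x hx => this x fun y => by rw [hcomm]; exact hx y⟩
  -- The space of cycles: orthogonality to the functions constant around white (black) vertices says
  -- that the sum around each such vertex vanishes.
  let Z := B.orthogonal (I S ⊔ I T)
  -- An edge separates the faces of `a` and `τ⁻¹ a`, so `ψ₀ p` is the boundary of the face chain
  -- `p`.
  let ψ₀ : (α → K) →ₗ[K] (α → K) := LinearMap.id + LinearMap.funLeft K K (τ⁻¹ : Equiv.Perm α)
  have hψ₀ : ∀ p a, ψ₀ p a = p a + p (τ⁻¹ a) := fun _ _ => rfl
  let ψ := ψ₀.domRestrict (I F)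
  have htwo : ∀ u v : K, u + v = 0 ↔ u = v := fun u v => by
    rw [add_eq_zero_iff_eq_neg, ZModModule.neg_eq_self]
  -- A face function with zero boundary is invariant under `τ`, hence also under `σ`, so it is
  -- constant on components.
  have hker : Module.finrank K (LinearMap.ker ψ)
      ≤ Nat.card (MulAction.orbitRel.Quotient (Subgroup.closure {σ, τ}) α) := by
    have h1 := finrank_invariantChains K (MulAction.orbitRel (Subgroup.closure {σ, τ}) α)
    rw [MulAction.orbitRel.Quotient, ← h1]
    rw [(Submodule.equivSubtypeMap (I F) (LinearMap.ker ψ)).finrank_eq]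
    refine Submodule.finrank_mono ?_
    rintro x ⟨⟨y, hy⟩, hk, rfl⟩
    rw [mem_invariantChains_orbitRel]
    have hy' := mem_invariantChains_sameCycle.1 hy
    have hk' : ∀ a, y (τ a) = y a := by
      intro a
      have := congrFun (LinearMap.mem_ker.1 hk) (τ a)
      have h2 : y (τ a) + y (τ⁻¹ (τ a)) = 0 := this
      rw [perm_inv_apply] at h2
      exact (htwo _ _).1 h2
    refine ⟨fun a => ?_, hk'⟩
    have h3 := hy' (τ⁻¹ a)
    rw [Equiv.Perm.mul_apply, perm_apply_inv] at h3
    change y (σ a) = y a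
    rw [h3, ← hk' (τ⁻¹ a), perm_apply_inv]
  have hrange : LinearMap.range ψ ≤ Z := by
    rintro _ ⟨⟨p, hp⟩, rfl⟩
    have hp' := mem_invariantChains_sameCycle.1 hp
    have hcycle : ∀ y ∈ I S ⊔ I T, B y (ψ₀ p) = 0 := by
      intro y hy
      obtain ⟨u, hu, v, hv, rfl⟩ := Submodule.mem_sup.1 hy
      have hu' := mem_invariantChains_sameCycle.1 hu
      have hv' := mem_invariantChains_sameCycle.1 hv
      have e1 : ∑ a, v a * p (τ⁻¹ a) = ∑ a, v a * p a := by
        rw [← Equiv.sum_comp τ]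
        simp [hv']
      have e2 : ∑ a, u a * p (τ⁻¹ a) = ∑ a, u a * p a := by
        rw [← Equiv.sum_comp τ, ← Equiv.sum_comp σ (fun a => u a * p a),
          ← Equiv.sum_comp τ (fun a => u (σ a) * p (σ a))]
        refine Finset.sum_congr rfl fun a _ => ?_
        have := hp' a
        rw [Equiv.Perm.mul_apply] at this
        rw [hu', this, perm_inv_apply]
      rw [map_add, LinearMap.add_apply, hB, hB]
      simp only [hψ₀, mul_add, Finset.sum_add_distrib, e1, e2, CharTwo.add_self_eq_zero]
    exact fun y hy => hcycle y hy
  -- With `V` vertices, `F` faces and `c` components, the cycle space has dimension `E - V + c` and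
  -- the face boundaries have dimension at least `F - c`. Euler's formula equates these two numbers.
  have hfin : Module.finrank K Z ≤ Module.finrank K (LinearMap.range ψ) := by
    have h1 := LinearMap.finrank_range_add_finrank_ker ψ
    have h2 : Module.finrank K (I F) = permCycleCount (σ * τ) := finrank_invariantChains K F
    have h3 : Module.finrank K (I S) = permCycleCount σ := finrank_invariantChains K S
    have h4 : Module.finrank K (I T) = permCycleCount τ := finrank_invariantChains K T
    have h5 := Submodule.finrank_sup_add_finrank_inf_eq (I S) (I T)
    have h6 : Module.finrank K (I S ⊓ I T : Submodule K (α → K))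
        = Nat.card (MulAction.orbitRel.Quotient (Subgroup.closure {σ, τ}) α) := by
      rw [show I S ⊓ I T = _ from invariantChains_inf σ τ, finrank_invariantChains,
        MulAction.orbitRel.Quotient]
    have h7 : Module.finrank K Z = _ := LinearMap.BilinForm.finrank_orthogonal hnd (I S ⊔ I T)
    rw [Module.finrank_fintype_fun_eq_card] at h7
    have h8 := Submodule.finrank_le (I S ⊔ I T)
    rw [Module.finrank_fintype_fun_eq_card] at h8
    omega
  have heq := Submodule.eq_of_le_of_finrank_le hrange hfin
  have hz : z ∈ Z := by
    intro y hy
    obtain ⟨u, hu, v, hv, rfl⟩ := Submodule.mem_sup.1 hy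
    change B (u + v) z = 0
    rw [hcomm, map_add, hB, hB, hσ u (mem_invariantChains_sameCycle.1 hu),
      hτ v (mem_invariantChains_sameCycle.1 hv), add_zero]
  rw [← heq] at hz
  obtain ⟨⟨p, hp⟩, rfl⟩ := hz
  exact ⟨p, mem_invariantChains_sameCycle.1 hp, fun a => rfl⟩

end ChainsModTwo

/-! ## Pairings along words -/

section OrderedPairing

variable {α K : Type*}

/-- The sum of `x a * y b` over all pairs of positions with `a` before `b`. -/
def orderedPairing [NonUnitalNonAssocSemiring K] (x y : α → K) : List α → K
  | [] => 0
  | a :: l => x a * (l.map y).sum + orderedPairing x y l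

theorem orderedPairing_add_left [NonUnitalNonAssocSemiring K] (x x' y : α → K) (l : List α) :
    orderedPairing (x + x') y l = orderedPairing x y l + orderedPairing x' y l := by
  induction l with
  | nil => simp [orderedPairing]
  | cons a l ih => simp only [orderedPairing, ih, Pi.add_apply, add_mul]; abel

theorem orderedPairing_add_right [NonUnitalNonAssocSemiring K] (x y y' : α → K) (l : List α) :
    orderedPairing x (y + y') l = orderedPairing x y l + orderedPairing x y' l := by
  induction l with
  | nil => simp [orderedPairing]
  | cons a l ih =>
    have h : (l.map (y + y')).sum = (l.map y).sum + (l.map y').sum := List.sum_map_add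
    simp only [orderedPairing, ih, h, mul_add]; abel

theorem orderedPairing_append [NonUnitalNonAssocSemiring K] (x y : α → K) (l l' : List α) :
    orderedPairing x y (l ++ l')
      = orderedPairing x y l + (l.map x).sum * (l'.map y).sum + orderedPairing x y l' := by
  induction l with
  | nil => simp [orderedPairing]
  | cons a l ih =>
    simp only [orderedPairing, ih, List.cons_append, List.map_append, List.sum_append,
      List.map_cons, List.sum_cons, mul_add, add_mul]; abel

theorem orderedPairing_reverse [CommSemiring K] (x y : α → K) (l : List α) :
    orderedPairing x y l.reverse = orderedPairing y x l := by
  induction l with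
  | nil => rfl
  | cons a l ih =>
    rw [List.reverse_cons, orderedPairing_append, ih]
    simp [orderedPairing, mul_comm, add_comm]

/-- Ordered pairs of positions are split according to which position comes first, with the diagonal
apart. -/
theorem orderedPairing_add_swap [CommSemiring K] (x y : α → K) (l : List α) :
    orderedPairing x y l + orderedPairing y x l + (l.map fun a => x a * y a).sum
      = (l.map x).sum * (l.map y).sum := by
  induction l with
  | nil => simp [orderedPairing]
  | cons a l ih =>
    simp only [orderedPairing, List.map_cons, List.sum_cons, add_mul, mul_add, ← ih]
    ring

/-- Along a chain of the permutation `τ`, the pairing with the coboundary of `p` telescopes. -/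
theorem orderedPairing_coboundary {τ : Equiv.Perm α} (x p : α → ZMod 2) :
    ∀ (l : List α), l.IsChain (fun a b => b = τ a) → (l.map x).sum = 0 →
      orderedPairing x (fun a => p a + p (τ⁻¹ a)) l = (l.map fun a => x a * p a).sum := by
  -- The coboundaries after a position telescope to the value of `p` there plus the value at the
  -- last position. The latter is common to all positions, so it multiplies the total of `x`, which
  -- is zero in the end; hence it does not matter where the cyclic word is cut.
  have key : ∀ (l : List α) (a : α), (a :: l).IsChain (fun a b => b = τ a) →
      (l.map fun a => p a + p (τ⁻¹ a)).sum = p ((a :: l).getLast (by simp)) + p a ∧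
      orderedPairing x (fun a => p a + p (τ⁻¹ a)) (a :: l)
        = p ((a :: l).getLast (by simp)) * ((a :: l).map x).sum
          + ((a :: l).map fun a => x a * p a).sum := by
    intro l
    induction l with
    | nil =>
      intro a _
      constructor
      · simp [CharTwo.add_self_eq_zero]
      · simp [orderedPairing, mul_comm, CharTwo.add_self_eq_zero]
    | cons b l ih =>
      intro a h
      rw [List.isChain_cons_cons] at h
      obtain ⟨rfl, h⟩ := h
      obtain ⟨h1, h2⟩ := ih _ h
      have h3 : ((τ a :: l).map fun a => p a + p (τ⁻¹ a)).sum
          = p ((τ a :: l).getLast (by simp)) + p a := by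
        rw [List.map_cons, List.sum_cons, h1, perm_inv_apply]
        linear_combination (CharTwo.add_self_eq_zero (p (τ a)))
      refine ⟨by rw [h3, List.getLast_cons_cons], ?_⟩
      rw [orderedPairing, h3, h2, List.getLast_cons_cons]
      simp only [List.map_cons, List.sum_cons]
      ring
  intro l hl hx
  cases l with
  | nil => rfl
  | cons a l => rw [(key l a hl).2, hx, mul_zero, zero_add]

theorem List.IsChain.eq_of_invariant {τ : Equiv.Perm α} {y : α → K} (hy : ∀ a, y (τ a) = y a)
    {l : List α} (hl : l.IsChain (fun a b => b = τ a)) :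
    ∀ a ∈ l, ∀ b ∈ l, y a = y b := by
  have : ∀ (l : List α) (a : α), (a :: l).IsChain (fun a b => b = τ a) →
      ∀ b ∈ a :: l, y b = y a := by
    intro l
    induction l with
    | nil => intro a _ b hb; rw [List.mem_singleton.1 hb]
    | cons c l ih =>
      intro a h b hb
      rw [List.isChain_cons_cons] at h
      obtain ⟨rfl, h⟩ := h
      rcases List.mem_cons.1 hb with rfl | hb
      · rfl
      · rw [ih _ h b hb, hy]
  cases l with
  | nil => simp
  | cons c l => intro a ha b hb; rw [this l c hl a ha, this l c hl b hb]

end OrderedPairing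

/-! ### The ordered pairing of chains around all vertices of a map. -/

section TotalPairing

variable {α ι κ : Type*}

/-- The sum of the ordered pairings along all words of two families. -/
def totalPairing [Fintype ι] [Fintype κ] {K : Type*} [NonUnitalNonAssocSemiring K]
    (ws : ι → List α) (bs : κ → List α) (x y : α → K) : K :=
  ∑ i, orderedPairing x y (ws i) + ∑ j, orderedPairing x y (bs j)

theorem totalPairing_add_left [Fintype ι] [Fintype κ] (ws : ι → List α) (bs : κ → List α)
    (x x' y : α → ZMod 2) :
    totalPairing ws bs (x + x') y = totalPairing ws bs x y + totalPairing ws bs x' y := by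
  simp only [totalPairing, orderedPairing_add_left, Finset.sum_add_distrib]; ring

theorem totalPairing_add_right [Fintype ι] [Fintype κ] (ws : ι → List α) (bs : κ → List α)
    (x y y' : α → ZMod 2) :
    totalPairing ws bs x (y + y') = totalPairing ws bs x y + totalPairing ws bs x y' := by
  simp only [totalPairing, orderedPairing_add_right, Finset.sum_add_distrib]; ring

/-- The words of `ws` enumerate the elements of `α`. -/
def Enumerates [Fintype α] [Fintype ι] (ws : ι → List α) : Prop :=
  ∀ f : α → ZMod 2, ∑ i, ((ws i).map f).sum = ∑ a, f a

/-- The cycles modulo two for the vertices given by two families of words. -/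
def IsCycleModTwo (ws : ι → List α) (bs : κ → List α) (z : α → ZMod 2) : Prop :=
  (∀ i, ((ws i).map z).sum = 0) ∧ ∀ j, ((bs j).map z).sum = 0

variable [Fintype α] [Fintype ι] [Fintype κ]

/-- Every edge occurs once in a white word and once in a black word, so the diagonal terms of
`orderedPairing_add_swap` appear twice and cancel modulo two. -/
theorem totalPairing_add_swap {ws : ι → List α} {bs : κ → List α} (hws : Enumerates ws)
    (hbs : Enumerates bs) (x y : α → ZMod 2) :
    totalPairing ws bs x y + totalPairing ws bs y x
      = ∑ i, ((ws i).map x).sum * ((ws i).map y).sum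
        + ∑ j, ((bs j).map x).sum * ((bs j).map y).sum := by
  simp only [← orderedPairing_add_swap, Finset.sum_add_distrib, totalPairing]
  rw [hws, hbs]
  linear_combination -CharTwo.add_self_eq_zero (∑ a, x a * y a)

/-- It suffices that one argument is a cycle: each product of vertex sums then has a zero factor. -/
theorem totalPairing_comm {ws : ι → List α} {bs : κ → List α} (hws : Enumerates ws)
    (hbs : Enumerates bs) {x : α → ZMod 2} (hx : IsCycleModTwo ws bs x) (y : α → ZMod 2) :
    totalPairing ws bs x y = totalPairing ws bs y x := by
  have := totalPairing_add_swap hws hbs x y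
  simp only [hx.1, hx.2, zero_mul, Finset.sum_const_zero, add_zero] at this
  rwa [add_eq_zero_iff_eq_neg, ZModModule.neg_eq_self] at this

/-- In a planar map the ordered pairing of two cycles is the number of common edges. -/
theorem totalPairing_eq_of_planar {σ τ : Equiv.Perm α}
    (h : permCycleCount σ + permCycleCount τ + permCycleCount (σ * τ) = Fintype.card α
      + 2 * Nat.card (MulAction.orbitRel.Quotient (Subgroup.closure {σ, τ}) α))
    {ws : ι → List α} {bs : κ → List α} (hws : Enumerates ws) (hbs : Enumerates bs)
    (hσ : ∀ i, (ws i).IsChain (fun a b => b = σ a)) (hτ : ∀ j, (bs j).IsChain (fun a b => b = τ a))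
    {x z : α → ZMod 2} (hx : IsCycleModTwo ws bs x) (hz : IsCycleModTwo ws bs z) :
    totalPairing ws bs x z = ∑ a, x a * z a := by
  -- A test function that is constant around a vertex factors out and leaves the sum of the cycle at
  -- that vertex.
  have aux : ∀ (ρ : Equiv.Perm α) (l : List α), l.IsChain (fun a b => b = ρ a) →
      (l.map z).sum = 0 → ∀ y : α → ZMod 2, (∀ a, y (ρ a) = y a) →
        (l.map fun a => z a * y a).sum = 0 := by
    intro ρ l hl hs y hy
    cases l with
    | nil => rfl
    | cons a l =>
      have : ((a :: l).map fun b => z b * y b) = (a :: l).map fun b => z b * y a :=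
        List.map_congr_left fun b hb => by rw [hl.eq_of_invariant hy b hb a (by simp)]
      rw [this, List.sum_map_mul_right, hs, zero_mul]
  obtain ⟨p, hp, hpz⟩ := exists_face_potential h z
    (fun y hy => by
      rw [← hws]
      exact Finset.sum_eq_zero fun i _ => aux σ _ (hσ i) (hz.1 i) y hy)
    (fun y hy => by
      rw [← hbs]
      exact Finset.sum_eq_zero fun i _ => aux τ _ (hτ i) (hz.2 i) y hy)
  -- Since `p` is constant on faces, `z` is also a coboundary for `σ`, of the shifted function `p ∘
  -- τ⁻¹`. White vertices therefore contribute one face of each edge and black vertices the other;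
  -- the two add up to `z`.
  have hw : ∀ i, orderedPairing x z (ws i) = ((ws i).map fun a => x a * p (τ⁻¹ a)).sum := by
    intro i
    rw [← orderedPairing_coboundary x (fun a => p (τ⁻¹ a)) _ (hσ i) (hx.1 i)]
    congr 1
    funext a
    rw [hpz a, add_comm, ← hp (τ⁻¹ (σ⁻¹ a)), perm_apply_inv, perm_apply_inv]
  have hb : ∀ j, orderedPairing x z (bs j) = ((bs j).map fun a => x a * p a).sum := by
    intro j
    rw [← orderedPairing_coboundary x p _ (hτ j) (hx.2 j)]
    congr 1
    funext a
    exact hpz a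
  rw [totalPairing, Finset.sum_congr rfl fun i _ => hw i, Finset.sum_congr rfl fun j _ => hb j,
    hws, hbs, ← Finset.sum_add_distrib]
  refine Finset.sum_congr rfl fun a _ => ?_
  rw [hpz a]; ring

/-- The sum over pairs of colours of the pairings of their edge sets depends only on the
multiplicities. The `u c` are the edge sets of the colours, modulo two. -/
theorem sum_totalPairing_eq {C : Type*} [Fintype C] [LinearOrder C] {ws : ι → List α}
    {bs : κ → List α} (hws : Enumerates ws) (hbs : Enumerates bs)
    (hplanar : ∀ x z, IsCycleModTwo ws bs x → IsCycleModTwo ws bs z →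
      totalPairing ws bs x z = ∑ a, x a * z a)
    {u v : C → α → ZMod 2} {a₀ : α → ZMod 2} (hu : ∀ c, IsCycleModTwo ws bs (u c + a₀))
    (hv : ∀ c, IsCycleModTwo ws bs (v c + a₀)) (huv : ∑ c, u c = ∑ c, v c)
    (hpairs : ∀ a, ∑ p : C × C with p.1 < p.2, u p.1 a * u p.2 a
      = ∑ p : C × C with p.1 < p.2, v p.1 a * v p.2 a) :
    ∑ p : C × C with p.1 < p.2, totalPairing ws bs (u p.2) (u p.1)
      = ∑ p : C × C with p.1 < p.2, totalPairing ws bs (v p.2) (v p.1) := by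
  -- Pairing a chain with the base chain `a₀` and adding the number of common edges is additive, and
  -- this collects all terms that are linear in a colour class.
  set M : (α → ZMod 2) → ZMod 2 := fun x => totalPairing ws bs x a₀ + ∑ a, x a * a₀ a with hM
  have Madd : ∀ x y, M (x + y) = M x + M y := fun x y => by
    simp only [hM, totalPairing_add_left, Pi.add_apply, add_mul, Finset.sum_add_distrib]; ring
  have htwo : ∀ x : α → ZMod 2, x + x = 0 := fun x => by
    funext a; exact CharTwo.add_self_eq_zero _
  -- Each class is `a₀` plus a cycle. Bilinearity gives four terms; the mixed ones are symmetric
  -- because one argument is a cycle, and the term with two cycles is evaluated by planarity.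
  have expand : ∀ w : C → α → ZMod 2, (∀ c, IsCycleModTwo ws bs (w c + a₀)) → ∀ c d,
      totalPairing ws bs (w d) (w c) = M a₀ + M (w c + a₀) + M (w d + a₀)
        + ∑ a, w c a * w d a := by
    intro w hw c d
    have e1 : w c = a₀ + (w c + a₀) := by rw [add_comm (w c), ← add_assoc, htwo, zero_add]
    have e2 : w d = a₀ + (w d + a₀) := by rw [add_comm (w d), ← add_assoc, htwo, zero_add]
    have h1 := hplanar _ _ (hw d) (hw c)
    have h2 := totalPairing_comm hws hbs (hw c) a₀
    have hs : ∑ a, w c a * w d a = ∑ a, a₀ a * a₀ a + ∑ a, (w c + a₀) a * a₀ a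
        + ∑ a, (w d + a₀) a * a₀ a + ∑ a, (w d + a₀) a * (w c + a₀) a := by
      simp only [← Finset.sum_add_distrib, Pi.add_apply]
      refine Finset.sum_congr rfl fun a _ => ?_
      linear_combination -(w c a * a₀ a + w d a * a₀ a + 2 * a₀ a ^ 2)
        * (CharTwo.two_eq_zero (R := ZMod 2))
    have h3 : totalPairing ws bs (w d) (w c) = totalPairing ws bs a₀ a₀
        + totalPairing ws bs (w c + a₀) a₀ + totalPairing ws bs (w d + a₀) a₀
        + totalPairing ws bs (w d + a₀) (w c + a₀) := by
      calc totalPairing ws bs (w d) (w c)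
          = totalPairing ws bs (a₀ + (w d + a₀)) (a₀ + (w c + a₀)) := by rw [← e1, ← e2]
        _ = _ := by
          rw [totalPairing_add_left ws bs a₀ (w d + a₀),
            totalPairing_add_right ws bs a₀ a₀ (w c + a₀),
            totalPairing_add_right ws bs (w d + a₀) a₀ (w c + a₀), h2]
          ring
    rw [h3, h1, hs]
    simp only [hM]
    linear_combination -(∑ a, a₀ a * a₀ a + ∑ a, (w c + a₀) a * a₀ a + ∑ a, (w d + a₀) a * a₀ a)
      * (CharTwo.two_eq_zero (R := ZMod 2))
  -- Each colour lies in `|C| - 1` pairs, which is `|C| + 1` modulo two. So only the sum of all the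
  -- classes enters.
  have sumM : ∀ w : C → α → ZMod 2, ∑ p : C × C with p.1 < p.2, (M (w p.1 + a₀) + M (w p.2 + a₀))
      = ∑ _d : C, (M (∑ c, w c) + ∑ _c : C, M a₀) + M (∑ c, w c) + ∑ _c : C, M a₀ := by
    intro w
    have Msum : M (∑ c, w c) = ∑ c, M (w c) := map_sum (AddMonoidHom.mk' M Madd) _ _
    have h1 : ∀ c d, (if c < d then M (w c + a₀) + M (w d + a₀) else 0)
        = (if c < d then M (w c + a₀) else 0) + (if c < d then M (w d + a₀) else 0) := by
      intro c d; split_ifs <;> simp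
    have h2 : ∀ c, (∑ d, if c < d then M (w c + a₀) else 0)
        + (∑ d, if d < c then M (w c + a₀) else 0)
        = ∑ _d : C, M (w c + a₀) + M (w c + a₀) := by
      intro c
      have h3 : M (w c + a₀) = ∑ d, if d = c then M (w c + a₀) else 0 := by simp
      rw [← sub_eq_iff_eq_add, sub_eq_add_neg, ZModModule.neg_eq_self]
      nth_rw 3 [h3]
      simp only [← Finset.sum_add_distrib]
      refine Finset.sum_congr rfl fun d _ => ?_
      rcases lt_trichotomy c d with h | h | h
      · simp [h, h.ne', h.not_gt]
      · simp [h]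
      · simp [h, h.ne, h.not_gt]
    rw [Msum, Finset.sum_filter, Fintype.sum_prod_type]
    simp only [h1, Finset.sum_add_distrib]
    rw [Finset.sum_comm (f := fun c d => if c < d then M (w d + a₀) else 0),
      ← Finset.sum_add_distrib, Finset.sum_congr rfl fun c _ => h2 c, Finset.sum_add_distrib,
      Finset.sum_comm]
    simp only [Madd, Finset.sum_add_distrib]
    ring
  have total : ∀ w : C → α → ZMod 2, (∀ c, IsCycleModTwo ws bs (w c + a₀)) →
      ∑ p : C × C with p.1 < p.2, totalPairing ws bs (w p.2) (w p.1)
        = ∑ p : C × C with p.1 < p.2, M a₀ + (∑ _d : C, (M (∑ c, w c) + ∑ _c : C, M a₀)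
          + M (∑ c, w c) + ∑ _c : C, M a₀)
          + ∑ a, ∑ p : C × C with p.1 < p.2, w p.1 a * w p.2 a := by
    intro w hw
    rw [← sumM, Finset.sum_comm, ← Finset.sum_add_distrib, ← Finset.sum_add_distrib]
    refine Finset.sum_congr rfl fun p _ => ?_
    rw [expand w hw]
    ring
  rw [total u hu, total v hv, huv, Finset.sum_congr rfl fun a _ => hpairs a]

end TotalPairing

/-! ## Inversions of block words -/

section Inversions

variable {r : ℕ}

/-- The number of pairs formed by a letter of `u` and a smaller letter of `v`. -/
def crossings (u v : List (Fin r)) : ℕ := (u.map fun a => v.countP (fun b => b < a)).sum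

theorem inversions_append (u v : List (Fin r)) :
    inversions (u ++ v) = inversions u + crossings u v + inversions v := by
  induction u with
  | nil => simp [inversions, crossings]
  | cons a u ih =>
    simp only [List.cons_append, inversions, ih, List.countP_append, crossings, List.map_cons,
      List.sum_cons]
    omega

theorem crossings_perm {u u' v v' : List (Fin r)} (hu : u.Perm u') (hv : v.Perm v') :
    crossings u v = crossings u' v' := by
  unfold crossings
  rw [(hu.map _).sum_eq]
  congr 1
  exact List.map_congr_left fun a _ => hv.countP_eq _

/-- A letter of `u` and a letter of `v` are distinct, so they are inverted in exactly one of the two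
orders. -/
theorem crossings_add_swap {u v : List (Fin r)} (h : u.Disjoint v) :
    crossings u v + crossings v u = u.length * v.length := by
  have swap : ∀ (a : Fin r) (u v : List (Fin r)), crossings v (a :: u)
      = v.countP (fun b => a < b) + crossings v u := by
    intro a u v
    induction v with
    | nil => rfl
    | cons b v ih =>
      simp only [crossings, List.map_cons, List.sum_cons, List.countP_cons] at ih ⊢
      rw [ih]; simp only [decide_eq_true_eq]; omega
  have split : ∀ (a : Fin r) (v : List (Fin r)), a ∉ v →
      v.countP (fun b => b < a) + v.countP (fun b => a < b) = v.length := by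
    intro a v
    induction v with
    | nil => intro; rfl
    | cons b v ih =>
      intro h
      rw [List.mem_cons, not_or] at h
      have := ih h.2
      rcases lt_or_gt_of_ne h.1 with hlt | hlt
      · simp [hlt, hlt.le]; omega
      · simp [hlt, hlt.le]; omega
  induction u with
  | nil =>
    have : ∀ v : List (Fin r), crossings v [] = 0 := fun v => by simp [crossings]
    rw [this]; simp [crossings]
  | cons a u ih =>
    rw [List.disjoint_cons_left] at h
    rw [swap, List.length_cons, add_mul, ← ih h.2, one_mul, ← split a v h.1]
    simp only [crossings, List.map_cons, List.sum_cons]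
    omega

theorem inversions_eq_zero {l : List (Fin r)} (h : l.Pairwise (· ≤ ·)) : inversions l = 0 := by
  induction l with
  | nil => rfl
  | cons a l ih =>
    rw [List.pairwise_cons] at h
    rw [inversions, ih h.2, add_zero, List.countP_eq_zero]
    intro b hb
    simpa using h.1 b hb

@[simp] theorem inversions_sort (S : Finset (Fin r)) : inversions S.sort = 0 :=
  inversions_eq_zero (Finset.pairwise_sort _ _)

@[simp] theorem blockWord_nil : blockWord ([] : List (Finset (Fin r))) = [] := rfl

@[simp] theorem blockWord_cons (S : Finset (Fin r)) (l : List (Finset (Fin r))) :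
    blockWord (S :: l) = S.sort ++ blockWord l := rfl

@[simp] theorem blockWord_append (l l' : List (Finset (Fin r))) :
    blockWord (l ++ l') = blockWord l ++ blockWord l' := List.flatMap_append

/-- The indicator of a colour. -/
def colorIndicator (K : Type*) [Zero K] [One K] (c : Fin r) (S : Finset (Fin r)) : K :=
  if c ∈ S then 1 else 0

theorem count_sort (c : Fin r) (S : Finset (Fin r)) : S.sort.count c = colorIndicator ℕ c S := by
  rw [colorIndicator]
  split_ifs with h
  · exact List.count_eq_one_of_mem (Finset.sort_nodup _ _) (by simpa using h)
  · exact List.count_eq_zero_of_not_mem (by simpa using h)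

theorem count_blockWord (c : Fin r) (l : List (Finset (Fin r))) :
    (blockWord l).count c = (l.map (colorIndicator ℕ c)).sum := by
  induction l with
  | nil => rfl
  | cons S l ih => simp [ih, count_sort]

theorem countP_lt_eq_sum (w : List (Fin r)) (a : Fin r) :
    w.countP (fun b => b < a) = ∑ b with b < a, w.count b := by
  induction w with
  | nil => simp
  | cons c w ih =>
    simp only [List.countP_cons, List.count_cons, ih, Finset.sum_add_distrib, beq_iff_eq]
    congr 1
    simp

theorem crossings_sort (S : Finset (Fin r)) (l : List (Finset (Fin r))) :
    crossings S.sort (blockWord l) = ∑ p : Fin r × Fin r with p.1 < p.2,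
      colorIndicator ℕ p.2 S * (l.map (colorIndicator ℕ p.1)).sum := by
  have h1 : crossings S.sort (blockWord l)
      = ∑ a ∈ S, (blockWord l).countP (fun b => b < a) := by
    rw [crossings, Finset.sum_eq_multiset_sum, ← Finset.sort_eq S (· ≤ ·)]
    rfl
  rw [h1, Finset.sum_filter, Fintype.sum_prod_type_right,
    ← Finset.sum_subset (Finset.subset_univ S)]
  · refine Finset.sum_congr rfl fun a ha => ?_
    rw [countP_lt_eq_sum, Finset.sum_filter]
    refine Finset.sum_congr rfl fun b _ => ?_
    simp [count_blockWord, colorIndicator, ha]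
  · intro a _ ha
    simp [colorIndicator, ha]

/-- Blocks are ascending, so inversions occur only between different blocks. For colours `c < d`
they count the pairs in which a block with `d` precedes a block with `c`. This is the passage from
words to pairings of colour classes. -/
theorem inversions_blockWord (l : List (Finset (Fin r))) :
    inversions (blockWord l) = ∑ p : Fin r × Fin r with p.1 < p.2,
      orderedPairing (colorIndicator ℕ p.2) (colorIndicator ℕ p.1) l := by
  induction l with
  | nil => simp [orderedPairing, inversions]
  | cons S l ih =>
    rw [blockWord_cons, inversions_append, inversions_sort, zero_add, ih, crossings_sort,
      ← Finset.sum_add_distrib]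
    rfl

theorem orderedPairing_map {α β K : Type*} [NonUnitalNonAssocSemiring K] (x y : β → K) (f : α → β)
    (l : List α) : orderedPairing x y (l.map f) = orderedPairing (x ∘ f) (y ∘ f) l := by
  induction l with
  | nil => rfl
  | cons a l ih => simp [orderedPairing, ih, List.map_map]

theorem orderedPairing_natCast {α K : Type*} [CommSemiring K] (x y : α → ℕ) (l : List α) :
    ((orderedPairing x y l : ℕ) : K) = orderedPairing (fun a => (x a : K)) (fun a => (y a : K)) l := by
  induction l with
  | nil => simp [orderedPairing]
  | cons a l ih => simp [orderedPairing, ih, List.map_map, Function.comp_def]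

theorem natCast_inversions_blockWord_map {α : Type*} (ℓ : α → Finset (Fin r)) (l : List α) :
    (inversions (blockWord (l.map ℓ)) : ZMod 2) = ∑ p : Fin r × Fin r with p.1 < p.2,
      orderedPairing (fun a => colorIndicator (ZMod 2) p.2 (ℓ a))
        (fun a => colorIndicator (ZMod 2) p.1 (ℓ a)) l := by
  rw [inversions_blockWord, Nat.cast_sum]
  refine Finset.sum_congr rfl fun p _ => ?_
  rw [orderedPairing_map, orderedPairing_natCast]
  congr 1 <;> funext a <;> simp [colorIndicator]

theorem blockWord_map_filter {α : Type*} (ℓ : α → Finset (Fin r)) (P : α → Prop) [DecidablePred P]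
    (h : ∀ a, ¬ P a → ℓ a = ∅) (l : List α) :
    blockWord ((l.filter fun a => P a).map ℓ) = blockWord (l.map ℓ) := by
  induction l with
  | nil => rfl
  | cons a l ih =>
    by_cases ha : P a
    · simp [ha, ih]
    · simp [ha, ih, h a ha]

/-- The sign exponent of the word of a set preceded by its complement. -/
def complInversions (S : Finset (Fin r)) : ℕ := inversions (blockWord [Sᶜ, S])

theorem inversions_blockWord_pair (S T : Finset (Fin r)) :
    inversions (blockWord [S, T]) = crossings S.sort T.sort := by
  simp [inversions_append]

theorem inversions_compl_swap (S : Finset (Fin r)) :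
    inversions (blockWord [S, Sᶜ]) + complInversions S = S.card * (r - S.card) := by
  rw [complInversions, inversions_blockWord_pair, inversions_blockWord_pair, crossings_add_swap]
  · simp [Finset.card_compl]
  · intro c h1 h2
    simp_all

/-- Inversions across the join depend only on which letters lie on each side, so for this purpose
`l` can be replaced by its sorted word. The correction at a vertex is thus a function of one label
alone. -/
theorem inversions_append_block {l : List (Finset (Fin r))} {S : Finset (Fin r)}
    (h : (blockWord l).Perm Sᶜ.sort) :
    inversions (blockWord (l ++ [S])) = inversions (blockWord l) + complInversions S := by
  rw [complInversions, inversions_blockWord_pair, blockWord_append, inversions_append]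
  simp [crossings_perm h (List.Perm.refl S.sort)]

end Inversions

/-! ## Wedge products of basis vectors -/

section Wedge

variable {r : ℕ} {U : Type*} [AddCommGroup U] [Module ℂ U]

/-- The wedge of the basis vectors spelled by a word. -/
noncomputable def wedgeWord (E : Module.Basis (Fin r) ℂ U) (w : List (Fin r)) :
    ExteriorAlgebra ℂ U :=
  (w.map fun c => ExteriorAlgebra.ι ℂ (E c)).prod

theorem wedgeWord_cons (E : Module.Basis (Fin r) ℂ U) (a : Fin r) (w : List (Fin r)) :
    wedgeWord E (a :: w) = ExteriorAlgebra.ι ℂ (E a) * wedgeWord E w := by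
  simp [wedgeWord]

theorem wedgeWord_append (E : Module.Basis (Fin r) ℂ U) (v w : List (Fin r)) :
    wedgeWord E (v ++ w) = wedgeWord E v * wedgeWord E w := by
  simp [wedgeWord]

theorem exteriorBasis_eq_wedgeWord (E : Module.Basis (Fin r) ℂ U) (S : Finset (Fin r)) :
    E.ExteriorAlgebra S = wedgeWord E S.sort := by
  refine (ExteriorAlgebra.basis_apply_ofCard E rfl).trans
    ((ExteriorAlgebra.ιMulti_apply _).trans ?_)
  rw [wedgeWord]
  congr 1
  rw [← Finset.listMap_orderEmbOfFin_finRange S rfl, List.map_map, List.ofFn_eq_map]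
  rfl

theorem ι_mul_swap (x y : U) : ExteriorAlgebra.ι ℂ x * ExteriorAlgebra.ι ℂ y
    = -(ExteriorAlgebra.ι ℂ y * ExteriorAlgebra.ι ℂ x) :=
  eq_neg_of_add_eq_zero_left (ExteriorAlgebra.ι_add_mul_swap x y)

theorem ι_mul_wedgeWord_of_mem (E : Module.Basis (Fin r) ℂ U) {a : Fin r} {w : List (Fin r)}
    (h : a ∈ w) : ExteriorAlgebra.ι ℂ (E a) * wedgeWord E w = 0 := by
  induction w with
  | nil => simp at h
  | cons b w ih =>
    rw [wedgeWord_cons, ← mul_assoc]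
    rcases List.mem_cons.1 h with rfl | h
    · rw [ExteriorAlgebra.ι_sq_zero, zero_mul]
    · rw [ι_mul_swap, neg_mul, mul_assoc, ih h, mul_zero, neg_zero]

theorem wedgeWord_of_not_nodup (E : Module.Basis (Fin r) ℂ U) {w : List (Fin r)}
    (h : ¬ w.Nodup) : wedgeWord E w = 0 := by
  induction w with
  | nil => simp at h
  | cons a w ih =>
    rw [wedgeWord_cons]
    by_cases ha : a ∈ w
    · exact ι_mul_wedgeWord_of_mem E ha
    · rw [ih fun hw => h (List.nodup_cons.2 ⟨ha, hw⟩), mul_zero]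

/-- One step of insertion sort: the new vector anticommutes past each smaller one. -/
theorem wedgeWord_orderedInsert (E : Module.Basis (Fin r) ℂ U) (a : Fin r) {w : List (Fin r)}
    (hw : w.Pairwise (· ≤ ·)) (ha : a ∉ w) :
    wedgeWord E (a :: w)
      = (-1 : ℂ) ^ w.countP (fun b => b < a) • wedgeWord E (w.orderedInsert (· ≤ ·) a) := by
  induction w with
  | nil => simp
  | cons b w ih =>
    rw [List.pairwise_cons] at hw
    rw [List.mem_cons, not_or] at ha
    by_cases hab : a ≤ b
    · have : (b :: w).countP (fun b => b < a) = 0 := by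
        rw [List.countP_eq_zero]
        intro c hc
        rcases List.mem_cons.1 hc with rfl | hc
        · simpa using hab
        · simpa using hab.trans (hw.1 c hc)
      rw [this, pow_zero, one_smul, List.orderedInsert_cons, if_pos hab]
    · rw [List.orderedInsert_cons, if_neg hab, wedgeWord_cons E b, List.countP_cons,
        if_pos (by simpa using hab), pow_succ, mul_comm, mul_smul, ← mul_smul_comm,
        ← ih hw.2 ha.2, wedgeWord_cons, wedgeWord_cons, wedgeWord_cons, ← mul_assoc, ← mul_assoc,
        ι_mul_swap (E b), neg_mul, smul_neg, neg_smul, one_smul, neg_neg]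

theorem wedgeWord_of_nodup (E : Module.Basis (Fin r) ℂ U) {w : List (Fin r)} (h : w.Nodup) :
    wedgeWord E w = (-1 : ℂ) ^ inversions w • E.ExteriorAlgebra w.toFinset := by
  induction w with
  | nil => simp [exteriorBasis_eq_wedgeWord, inversions]
  | cons a w ih =>
    rw [List.nodup_cons] at h
    have hs : (a :: w).toFinset.sort = w.toFinset.sort.orderedInsert (· ≤ ·) a := by
      refine List.Perm.eq_of_pairwise' (r := (· ≤ ·)) (Finset.pairwise_sort _ _)
        (List.Pairwise.orderedInsert _ _ (Finset.pairwise_sort _ _)) ?_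
      refine List.Perm.trans ?_ (List.perm_orderedInsert _ _ _).symm
      rw [List.perm_ext_iff_of_nodup (Finset.sort_nodup _ _)
        (List.nodup_cons.2 ⟨by simpa using h.1, Finset.sort_nodup _ _⟩)]
      simp
    have hp : w.Perm w.toFinset.sort := by
      rw [List.perm_ext_iff_of_nodup h.2 (Finset.sort_nodup _ _)]
      simp
    rw [wedgeWord_cons, ih h.2, mul_smul_comm, exteriorBasis_eq_wedgeWord, ← wedgeWord_cons,
      wedgeWord_orderedInsert E a (Finset.pairwise_sort _ _) (by simpa using h.1), ← hs,
      ← exteriorBasis_eq_wedgeWord, smul_smul, ← pow_add, inversions, ← hp.countP_eq, add_comm]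

theorem prod_exteriorBasis (E : Module.Basis (Fin r) ℂ U) (l : List (Finset (Fin r))) :
    (l.map E.ExteriorAlgebra).prod = wedgeWord E (blockWord l) := by
  induction l with
  | nil => rfl
  | cons S l ih =>
    rw [List.map_cons, List.prod_cons, ih, blockWord_cons, wedgeWord_append,
      exteriorBasis_eq_wedgeWord]

/-- The coefficient of `E_S` in the wedge of the `E_B` for the blocks `B`. -/
def wedgeCoeff (blocks : List (Finset (Fin r))) (S : Finset (Fin r)) : ℤ :=
  if (blockWord blocks).Perm S.sort then (-1) ^ inversions (blockWord blocks) else 0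

theorem perm_sort_iff {w : List (Fin r)} {S : Finset (Fin r)} :
    w.Perm S.sort ↔ w.Nodup ∧ w.toFinset = S := by
  constructor
  · intro h
    refine ⟨h.nodup_iff.2 (Finset.sort_nodup _ _), ?_⟩
    ext c
    simp [h.mem_iff]
  · rintro ⟨h, rfl⟩
    rw [List.perm_ext_iff_of_nodup h (Finset.sort_nodup _ _)]
    simp

/-- A repeated letter kills the wedge; otherwise sorting the word leaves one basis vector with the
inversion sign. -/
theorem repr_prod_exteriorBasis (E : Module.Basis (Fin r) ℂ U) (l : List (Finset (Fin r)))
    (S : Finset (Fin r)) :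
    E.ExteriorAlgebra.repr (l.map E.ExteriorAlgebra).prod S = (wedgeCoeff l S : ℂ) := by
  rw [prod_exteriorBasis, wedgeCoeff]
  simp only [perm_sort_iff]
  by_cases h : (blockWord l).Nodup
  · rw [wedgeWord_of_nodup E h]
    by_cases hS : (blockWord l).toFinset = S
    · simp [h, hS]
    · simp [h, hS]
  · rw [wedgeWord_of_not_nodup E h]
    simp [h]

/-- A wedge of basis vectors is a multiple of one basis vector. -/
theorem prod_exteriorBasis_eq_smul (E : Module.Basis (Fin r) ℂ U) (l : List (Finset (Fin r))) :
    (l.map E.ExteriorAlgebra).prod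
        = (wedgeCoeff l (blockWord l).toFinset : ℂ) • E.ExteriorAlgebra (blockWord l).toFinset ∧
      ∀ S, S ≠ (blockWord l).toFinset → wedgeCoeff l S = 0 := by
  constructor
  · rw [prod_exteriorBasis, wedgeCoeff]
    simp only [perm_sort_iff]
    by_cases h : (blockWord l).Nodup
    · simp [wedgeWord_of_nodup E h, h]
    · simp [wedgeWord_of_not_nodup E h, h]
  · intro S hS
    rw [wedgeCoeff, if_neg]
    exact fun h => hS (perm_sort_iff.1 h).2.symm

end Wedge

/-! ## Words around the vertices -/

section CycleWord

variable {α : Type*}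

/-- The cycle of `e` as a word that ends with `e`. -/
noncomputable def cycleWord (σ : Equiv.Perm α) (e : α) : List α :=
  List.iterate σ (σ e) (Function.minimalPeriod σ e)

theorem mem_periodicPts_perm [Finite α] (σ : Equiv.Perm α) (e : α) :
    e ∈ Function.periodicPts σ :=
  (σ.injective.mem_periodicPts e)

theorem minimalPeriod_perm_apply [Finite α] (σ : Equiv.Perm α) (e : α) :
    Function.minimalPeriod σ (σ e) = Function.minimalPeriod σ e :=
  Function.minimalPeriod_apply (mem_periodicPts_perm σ e)

/-- A full turn that starts at `σ e` ends at `e`. The distinguished edge of a vertex is thus the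
last block, the position treated by `inversions_append_block`. -/
theorem cycleWord_eq_append [Finite α] (σ : Equiv.Perm α) (e : α) :
    cycleWord σ e = List.iterate σ (σ e) (Function.minimalPeriod σ e - 1) ++ [e] := by
  have hpos := Function.minimalPeriod_pos_of_mem_periodicPts (mem_periodicPts_perm σ e)
  obtain ⟨m, hm⟩ := Nat.exists_eq_succ_of_ne_zero hpos.ne'
  have he : σ^[m] (σ e) = e := by
    rw [← Function.iterate_succ_apply, ← hm, Function.iterate_minimalPeriod]
  rw [cycleWord, hm, Nat.succ_eq_add_one, List.iterate_add, Nat.add_sub_cancel, he]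
  rfl

theorem nodup_cycleWord [Finite α] (σ : Equiv.Perm α) (e : α) : (cycleWord σ e).Nodup := by
  rw [List.nodup_iff_injective_getElem]
  intro i j hij
  simp only [cycleWord, List.getElem_iterate] at hij
  have hi := i.2
  have hj := j.2
  simp only [cycleWord, List.length_iterate] at hi hj
  have := Function.iterate_injOn_Iio_minimalPeriod (f := σ) (x := σ e)
    (by simpa [minimalPeriod_perm_apply] using hi) (by simpa [minimalPeriod_perm_apply] using hj)
    hij
  exact Fin.ext this

theorem mem_cycleWord [Finite α] {σ : Equiv.Perm α} {e f : α} :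
    f ∈ cycleWord σ e ↔ σ.SameCycle e f := by
  rw [cycleWord, List.mem_iterate]
  constructor
  · rintro ⟨m, -, rfl⟩
    rw [← Function.iterate_succ_apply, ← Equiv.Perm.coe_pow]
    exact ⟨(m + 1 : ℕ), by rw [zpow_natCast]⟩
  · intro h
    obtain ⟨i, -, hi⟩ := Equiv.Perm.SameCycle.exists_pow_eq' (Equiv.Perm.sameCycle_apply_left.2 h)
    refine ⟨i % Function.minimalPeriod σ (σ e), ?_, ?_⟩
    · rw [← minimalPeriod_perm_apply σ e]
      exact Nat.mod_lt _ (Function.minimalPeriod_pos_of_mem_periodicPts (mem_periodicPts_perm σ _))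
    · rw [Function.iterate_mod_minimalPeriod_eq, ← Equiv.Perm.coe_pow, hi]

theorem isChain_iterate (f : α → α) (a : α) (n : ℕ) :
    (List.iterate f a n).IsChain (fun a b => b = f a) := by
  induction n generalizing a with
  | zero => exact List.IsChain.nil
  | succ n ih =>
    cases n with
    | zero => exact List.IsChain.singleton _
    | succ n => exact List.IsChain.cons_cons rfl (ih (f a))

theorem isChain_cycleWord (σ : Equiv.Perm α) (e : α) :
    (cycleWord σ e).IsChain (fun a b => b = σ a) := isChain_iterate _ _ _

theorem isChain_formPerm [DecidableEq α] {l : List α} (h : l.Nodup) :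
    l.IsChain (fun a b => b = l.formPerm a) := by
  rw [List.isChain_iff_getElem]
  intro i hi
  exact (List.formPerm_apply_lt_getElem l h i hi).symm

theorem List.IsChain.imp_of_mem {R S : α → α → Prop} {l : List α}
    (h : l.IsChain R) (H : ∀ a ∈ l, ∀ b ∈ l, R a b → S a b) : l.IsChain S := by
  rw [List.isChain_iff_getElem] at h ⊢
  intro i hi
  exact H _ (List.getElem_mem _) _ (List.getElem_mem _) (h i hi)

theorem List.sum_map_eq_sum_filter [Fintype α] {K : Type*} [AddCommMonoid K] {l : List α}
    (hl : l.Nodup) {P : α → Prop} [DecidablePred P] (hP : ∀ a, a ∈ l ↔ P a) (f : α → K) :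
    (l.map f).sum = ∑ a with P a, f a := by
  classical
  rw [← List.sum_toFinset f hl]
  congr 1
  ext a
  simp [hP]

end CycleWord

/-! ### The words around the vertices of a disk map and along its boundary. -/

namespace DiskMap

variable {n : ℕ} {Wh Bl Ed : Type*} [Fintype Ed] [DecidableEq Bl] [DecidableEq Ed]

theorem mem_boundaryEdges (G : DiskMap n Wh Bl Ed) (e : Ed) :
    e ∈ G.boundaryEdges ↔ ∃ i, G.black e = Sum.inr i := by
  simp [boundaryEdges]

theorem nodup_boundaryEdges (G : DiskMap n Wh Bl Ed) : G.boundaryEdges.Nodup := by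
  rw [boundaryEdges, List.nodup_flatMap]
  refine ⟨fun i _ => Finset.nodup_toList _, ?_⟩
  refine (List.nodup_finRange n).imp ?_
  intro i j hij e hi hj
  simp only [Finset.mem_toList, Finset.mem_filter, Finset.mem_univ, true_and] at hi hj
  exact hij (Sum.inr_injective (hi.symm.trans hj))

theorem rotBlack_boundary (G : DiskMap n Wh Bl Ed) {e : Ed} {i : Fin n}
    (h : G.black e = Sum.inr i) : G.rotBlack e = e := by
  have h1 := (G.sameCycle_rotBlack e (G.rotBlack e)).1 ⟨1, by simp⟩
  exact G.boundary_unique _ _ i (h1 ▸ h) h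

theorem collapsedRotBlack_eq (G : DiskMap n Wh Bl Ed) :
    G.collapsedRotBlack = G.rotBlack * G.boundaryEdges.reverse.formPerm := by
  rw [collapsedRotBlack, List.formPerm_reverse]

/-- The cycle of the reversed list is the inverse of the boundary cycle, and `rotBlack` fixes
boundary edges. So the collapsed vertex sees the boundary in clockwise order. -/
theorem isChain_boundaryEdges_reverse (G : DiskMap n Wh Bl Ed) :
    G.boundaryEdges.reverse.IsChain (fun a b => b = G.collapsedRotBlack a) := by
  refine (isChain_formPerm (List.nodup_reverse.2 G.nodup_boundaryEdges)).imp_of_mem ?_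
  rintro a - b hb rfl
  rw [List.mem_reverse, mem_boundaryEdges] at hb
  obtain ⟨i, hi⟩ := hb
  rw [collapsedRotBlack_eq, Equiv.Perm.mul_apply, G.rotBlack_boundary hi]

theorem collapsedRotBlack_interior (G : DiskMap n Wh Bl Ed) {e : Ed} {b : Bl}
    (h : G.black e = Sum.inl b) : G.collapsedRotBlack e = G.rotBlack e := by
  rw [collapsedRotBlack_eq, Equiv.Perm.mul_apply, List.formPerm_apply_of_notMem]
  rw [List.mem_reverse, mem_boundaryEdges]
  rintro ⟨i, hi⟩
  rw [h] at hi
  cases hi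

theorem isChain_cycleWord_black (G : DiskMap n Wh Bl Ed) {e : Ed} {b : Bl}
    (h : G.black e = Sum.inl b) :
    (cycleWord G.rotBlack e).IsChain (fun a b => b = G.collapsedRotBlack a) := by
  refine (isChain_cycleWord _ _).imp_of_mem ?_
  rintro a ha c - rfl
  rw [mem_cycleWord, G.sameCycle_rotBlack] at ha
  exact (G.collapsedRotBlack_interior (ha ▸ h)).symm

/-- The words of the interior black vertices, and the word of the boundary as seen from the vertex
to which the boundary circle is collapsed. -/
noncomputable def blackWords (G : DiskMap n Wh Bl Ed) (sB : Bl → Ed) : Option Bl → List Ed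
  | none => G.boundaryEdges.reverse
  | some b => cycleWord G.rotBlack (sB b)

theorem sum_cycleWord_white [DecidableEq Wh] (G : DiskMap n Wh Bl Ed) {K : Type*} [AddCommMonoid K]
    {e : Ed} {w : Wh} (h : G.white e = w) (f : Ed → K) :
    ((cycleWord G.rotWhite e).map f).sum = ∑ a with G.white a = w, f a :=
  List.sum_map_eq_sum_filter (nodup_cycleWord _ _)
    (fun a => by rw [mem_cycleWord, G.sameCycle_rotWhite, h, eq_comm]) f

theorem sum_cycleWord_black (G : DiskMap n Wh Bl Ed) {K : Type*} [AddCommMonoid K]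
    {e : Ed} {b : Bl} (h : G.black e = Sum.inl b) (f : Ed → K) :
    ((cycleWord G.rotBlack e).map f).sum = ∑ a with G.black a = Sum.inl b, f a :=
  List.sum_map_eq_sum_filter (nodup_cycleWord _ _)
    (fun a => by rw [mem_cycleWord, G.sameCycle_rotBlack, h, eq_comm]) f

theorem sum_boundaryEdges (G : DiskMap n Wh Bl Ed) {K : Type*} [AddCommMonoid K] (f : Ed → K) :
    (G.boundaryEdges.map f).sum = ∑ i, ∑ a with G.black a = Sum.inr i, f a := by
  rw [boundaryEdges, Fin.sum_univ_def]
  induction List.finRange n with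
  | nil => rfl
  | cons i l ih =>
    rw [List.flatMap_cons, List.map_append, List.sum_append, ih, Finset.sum_map_toList,
      List.map_cons, List.sum_cons]

theorem enumerates_white [Fintype Wh] [DecidableEq Wh] (G : DiskMap n Wh Bl Ed) {sW : Wh → Ed}
    (hW : ∀ w, G.white (sW w) = w) : Enumerates fun w => cycleWord G.rotWhite (sW w) := by
  intro f
  simp only [G.sum_cycleWord_white (hW _)]
  exact Finset.sum_fiberwise _ _ _

/-- With the boundary counted as one further black vertex, each edge has its black end in exactly
one word. -/
theorem enumerates_black [Fintype Bl] (G : DiskMap n Wh Bl Ed) {sB : Bl → Ed}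
    (hB : ∀ b, G.black (sB b) = Sum.inl b) : Enumerates (G.blackWords sB) := by
  intro f
  rw [Fintype.sum_option]
  simp only [blackWords, List.map_reverse, List.sum_reverse, G.sum_boundaryEdges,
    G.sum_cycleWord_black (hB _)]
  rw [← Finset.sum_fiberwise Finset.univ G.black f, Fintype.sum_sum_type, add_comm]

end DiskMap

/-! ## Consistent labelings -/

/-- The sum is the binomial coefficient `|A|` over two. The identity is stated in `ℕ` and without
division, since the factor two would be lost modulo two. -/
theorem sum_colorIndicator_pairs {r : ℕ} (A : Finset (Fin r)) :
    2 * (∑ p : Fin r × Fin r with p.1 < p.2, colorIndicator ℕ p.1 A * colorIndicator ℕ p.2 A)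
      + A.card = A.card * A.card := by
  have hcard : A.card = ∑ c, colorIndicator ℕ c A := by simp [colorIndicator]
  have hsq : ∀ c, colorIndicator ℕ c A * colorIndicator ℕ c A = colorIndicator ℕ c A := by
    intro c; unfold colorIndicator; split_ifs <;> rfl
  rw [hcard, Finset.sum_mul_sum, Finset.sum_filter, Fintype.sum_prod_type, two_mul]
  nth_rw 2 [Finset.sum_comm]
  rw [← Finset.sum_add_distrib, ← Finset.sum_add_distrib]
  refine Finset.sum_congr rfl fun c _ => ?_
  have hdiag : colorIndicator ℕ c A
      = ∑ d, if d = c then colorIndicator ℕ c A * colorIndicator ℕ d A else 0 := by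
    simp [hsq]
  conv_lhs => rw [hdiag]
  simp only [← Finset.sum_add_distrib]
  refine Finset.sum_congr rfl fun d _ => ?_
  rcases lt_trichotomy c d with h | h | h
  · simp [h, h.not_gt, h.ne']
  · simp [h]
  · simp [h, h.not_gt, h.ne, mul_comm]

theorem sum_colorIndicator_pairs_eq {r : ℕ} {A B : Finset (Fin r)} (h : A.card = B.card) :
    ∑ p : Fin r × Fin r with p.1 < p.2,
        colorIndicator (ZMod 2) p.1 A * colorIndicator (ZMod 2) p.2 A
      = ∑ p : Fin r × Fin r with p.1 < p.2,
        colorIndicator (ZMod 2) p.1 B * colorIndicator (ZMod 2) p.2 B := by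
  have cast : ∀ S : Finset (Fin r), ∑ p : Fin r × Fin r with p.1 < p.2,
        colorIndicator (ZMod 2) p.1 S * colorIndicator (ZMod 2) p.2 S
      = ((∑ p : Fin r × Fin r with p.1 < p.2,
          colorIndicator ℕ p.1 S * colorIndicator ℕ p.2 S : ℕ) : ZMod 2) := by
    intro S
    rw [Nat.cast_sum]
    refine Finset.sum_congr rfl fun p _ => ?_
    simp [colorIndicator]
  have h1 := sum_colorIndicator_pairs A
  have h2 := sum_colorIndicator_pairs B
  rw [← h] at h2
  rw [cast, cast]
  congr 1
  omega

/-- Covering gives at least one occurrence of each colour, and the sizes add up to the number `r` of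
colours, so equality holds for every colour. -/
theorem sum_colorIndicator_eq_one {r : ℕ} {α : Type*} {s : Finset α} {ℓ : α → Finset (Fin r)}
    (hu : s.biUnion ℓ = Finset.univ) (hc : ∑ e ∈ s, (ℓ e).card = r) (c : Fin r) :
    ∑ e ∈ s, colorIndicator ℕ c (ℓ e) = 1 := by
  have hge : ∀ c ∈ Finset.univ, 1 ≤ ∑ e ∈ s, colorIndicator ℕ c (ℓ e) := by
    intro c _
    have : c ∈ s.biUnion ℓ := hu ▸ Finset.mem_univ c
    obtain ⟨e, he, hce⟩ := Finset.mem_biUnion.1 this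
    calc 1 = colorIndicator ℕ c (ℓ e) := by simp [colorIndicator, hce]
      _ ≤ _ := Finset.single_le_sum (f := fun e => colorIndicator ℕ c (ℓ e))
        (fun _ _ => Nat.zero_le _) he
  have hsum : ∑ _c : Fin r, 1 = ∑ c, ∑ e ∈ s, colorIndicator ℕ c (ℓ e) := by
    rw [Finset.sum_comm]
    have : ∀ e, ∑ c, colorIndicator ℕ c (ℓ e) = (ℓ e).card := fun e => by simp [colorIndicator]
    simp [this, hc]
  exact ((Finset.sum_eq_sum_iff_of_le hge).1 hsum c (Finset.mem_univ c)).symm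

namespace DiskMap.Weblike

variable {n r : ℕ} {Wh Bl Ed : Type*} [Fintype Ed] [DecidableEq Wh] [DecidableEq Bl]
  [DecidableEq Ed] {G : DiskMap n Wh Bl Ed} {W : G.Weblike r} {ℓ : Ed → Finset (Fin r)}

theorem IsConsistent.sum_white (h : W.IsConsistent ℓ) (w : Wh) (c : Fin r) :
    ∑ e with G.white e = w, colorIndicator ℕ c (ℓ e) = 1 :=
  sum_colorIndicator_eq_one (h.union_white w) (by simp only [h.card_eq, W.sum_white]) c

theorem IsConsistent.sum_black (h : W.IsConsistent ℓ) (b : Bl) (c : Fin r) :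
    ∑ e with G.black e = Sum.inl b, colorIndicator ℕ c (ℓ e) = 1 :=
  sum_colorIndicator_eq_one (h.union_black b) (by simp only [h.card_eq, W.sum_black]) c

/-- The parity of the total number of inversions of the words of a labeling around the interior
vertices and along the boundary. -/
noncomputable def inversionParity (G : DiskMap n Wh Bl Ed) [Fintype Wh] [Fintype Bl] (sW : Wh → Ed)
    (sB : Bl → Ed) (ℓ : Ed → Finset (Fin r)) : ZMod 2 :=
  ∑ w, (inversions (blockWord ((cycleWord G.rotWhite (sW w)).map ℓ)) : ZMod 2)
    + ∑ b, (inversions (blockWord ((cycleWord G.rotBlack (sB b)).map ℓ)) : ZMod 2)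
    + (inversions (blockWord (G.boundaryEdges.map ℓ)) : ZMod 2)

/-- The colour classes of a labeling as chains modulo two. -/
def colorChain (ℓ : Ed → Finset (Fin r)) (c : Fin r) : Ed → ZMod 2 :=
  fun e => colorIndicator (ZMod 2) c (ℓ e)

theorem colorChain_eq_cast (ℓ : Ed → Finset (Fin r)) (c : Fin r) (e : Ed) :
    colorChain ℓ c e = (colorIndicator ℕ c (ℓ e) : ZMod 2) := by
  simp [colorChain, colorIndicator]

variable [Fintype Wh] [Fintype Bl] {sW : Wh → Ed} {sB : Bl → Ed}

theorem IsConsistent.sum_cycleWord_white (h : W.IsConsistent ℓ) (hW : ∀ w, G.white (sW w) = w)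
    (c : Fin r) (w : Wh) : ((cycleWord G.rotWhite (sW w)).map (colorChain ℓ c)).sum = 1 := by
  rw [G.sum_cycleWord_white (hW w)]
  simp only [colorChain_eq_cast]
  rw [← Nat.cast_sum, h.sum_white, Nat.cast_one]

theorem IsConsistent.sum_cycleWord_black (h : W.IsConsistent ℓ)
    (hB : ∀ b, G.black (sB b) = Sum.inl b)
    (c : Fin r) (b : Bl) : ((cycleWord G.rotBlack (sB b)).map (colorChain ℓ c)).sum = 1 := by
  rw [G.sum_cycleWord_black (hB b)]
  simp only [colorChain_eq_cast]
  rw [← Nat.cast_sum, h.sum_black, Nat.cast_one]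

/-- The edges of one colour are counted by their white ends and by their black ends: each interior
vertex has one, and the difference lies on the boundary. The value is the same for all colours. -/
theorem IsConsistent.sum_boundary (h : W.IsConsistent ℓ) (hW : ∀ w, G.white (sW w) = w)
    (hB : ∀ b, G.black (sB b) = Sum.inl b) (c : Fin r) :
    (G.boundaryEdges.map (colorChain ℓ c)).sum
      = (Fintype.card Wh : ZMod 2) - (Fintype.card Bl : ZMod 2) := by
  have h1 := G.enumerates_white hW (colorChain ℓ c)
  have h2 := G.enumerates_black hB (colorChain ℓ c)
  rw [Fintype.sum_option] at h2
  simp only [DiskMap.blackWords, h.sum_cycleWord_black hB, h.sum_cycleWord_white hW,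
    List.map_reverse, List.sum_reverse] at h1 h2
  rw [← h1] at h2
  simp only [Finset.sum_const, Finset.card_univ, nsmul_eq_mul, mul_one] at h2
  rw [← h2]; ring

/-- The boundary word enters the total pairing reversed, as seen from the collapsed vertex. Undoing
the reversal costs the square of the excedance for each pair of colours, plus the colour pairs on
each boundary edge; both are independent of the labeling. -/
theorem inversionParity_eq (h : W.IsConsistent ℓ) (hW : ∀ w, G.white (sW w) = w)
    (hB : ∀ b, G.black (sB b) = Sum.inl b) :
    inversionParity G sW sB ℓ
      = ∑ p : Fin r × Fin r with p.1 < p.2,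
          totalPairing (fun w => cycleWord G.rotWhite (sW w)) (G.blackWords sB)
            (colorChain ℓ p.2) (colorChain ℓ p.1)
        + ∑ p : Fin r × Fin r with p.1 < p.2,
            ((Fintype.card Wh : ZMod 2) - (Fintype.card Bl : ZMod 2)) ^ 2
        + (G.boundaryEdges.map fun e => ∑ p : Fin r × Fin r with p.1 < p.2,
            colorIndicator (ZMod 2) p.1 (ℓ e) * colorIndicator (ZMod 2) p.2 (ℓ e)).sum := by
  have hswap : ∀ p : Fin r × Fin r,
      orderedPairing (colorChain ℓ p.2) (colorChain ℓ p.1) G.boundaryEdges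
        = orderedPairing (colorChain ℓ p.1) (colorChain ℓ p.2) G.boundaryEdges
          + ((Fintype.card Wh : ZMod 2) - (Fintype.card Bl : ZMod 2)) ^ 2
          + (G.boundaryEdges.map fun e => colorIndicator (ZMod 2) p.1 (ℓ e)
            * colorIndicator (ZMod 2) p.2 (ℓ e)).sum := by
    intro p
    have := orderedPairing_add_swap (colorChain ℓ p.1) (colorChain ℓ p.2) G.boundaryEdges
    rw [h.sum_boundary hW hB, h.sum_boundary hW hB] at this
    simp only [colorChain] at this ⊢
    linear_combination this - (orderedPairing (colorChain ℓ p.1) (colorChain ℓ p.2) G.boundaryEdges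
      + (G.boundaryEdges.map fun e => colorIndicator (ZMod 2) p.1 (ℓ e)
            * colorIndicator (ZMod 2) p.2 (ℓ e)).sum) * (CharTwo.two_eq_zero (R := ZMod 2))
  have hb : (inversions (blockWord (G.boundaryEdges.map ℓ)) : ZMod 2)
      = ∑ p : Fin r × Fin r with p.1 < p.2,
        orderedPairing (colorChain ℓ p.2) (colorChain ℓ p.1) G.boundaryEdges :=
    natCast_inversions_blockWord_map _ _
  have hsum : (G.boundaryEdges.map fun e => ∑ p : Fin r × Fin r with p.1 < p.2,
        colorIndicator (ZMod 2) p.1 (ℓ e) * colorIndicator (ZMod 2) p.2 (ℓ e)).sum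
      = ∑ p : Fin r × Fin r with p.1 < p.2, (G.boundaryEdges.map fun e =>
        colorIndicator (ZMod 2) p.1 (ℓ e) * colorIndicator (ZMod 2) p.2 (ℓ e)).sum := by
    induction G.boundaryEdges with
    | nil => simp
    | cons a l ih => simp [ih, Finset.sum_add_distrib]
  rw [inversionParity, hb, hsum, Finset.sum_congr rfl fun p _ => hswap p]
  simp only [natCast_inversions_blockWord_map, totalPairing, Fintype.sum_option,
    DiskMap.blackWords, orderedPairing_reverse, Finset.sum_add_distrib]
  rw [Finset.sum_comm, Finset.sum_comm (s := (Finset.univ : Finset Bl))]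
  change _ + _ + (_ + _ + _) = _ + (_ + _) + _ + _
  simp only [show ∀ c, colorChain ℓ c = fun e => colorIndicator (ZMod 2) c (ℓ e) from fun _ => rfl]
  ring

/-- The parity of the inversions is the same for all consistent labelings of a planar web. -/
theorem inversionParity_congr (hG : G.Planar) {ℓ' : Ed → Finset (Fin r)} (h : W.IsConsistent ℓ)
    (h' : W.IsConsistent ℓ') (hW : ∀ w, G.white (sW w) = w)
    (hB : ∀ b, G.black (sB b) = Sum.inl b) :
    inversionParity G sW sB ℓ = inversionParity G sW sB ℓ' := by
  have hcard : ∀ e, (ℓ e).card = (ℓ' e).card := fun e => by rw [h.card_eq, h'.card_eq]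
  rw [inversionParity_eq h hW hB, inversionParity_eq h' hW hB]
  congr 1
  · congr 1
    -- One colour class of the first labeling serves as base chain for both labelings. Without
    -- colours there is nothing to compare.
    rcases isEmpty_or_nonempty (Fin r) with hr | ⟨⟨c₀⟩⟩
    · simp
    have hcycle : ∀ {ℓ₁ : Ed → Finset (Fin r)}, W.IsConsistent ℓ₁ → ∀ c,
        IsCycleModTwo (fun w => cycleWord G.rotWhite (sW w)) (G.blackWords sB)
          (colorChain ℓ₁ c + colorChain ℓ c₀) := by
      intro ℓ₁ h₁ c
      have hadd : ∀ l : List Ed, (l.map (colorChain ℓ₁ c + colorChain ℓ c₀)).sum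
          = (l.map (colorChain ℓ₁ c)).sum + (l.map (colorChain ℓ c₀)).sum :=
        fun l => List.sum_map_add
      constructor
      · intro w
        rw [hadd, h₁.sum_cycleWord_white hW, h.sum_cycleWord_white hW,
          CharTwo.add_self_eq_zero]
      · rintro (_ | b) <;> rw [hadd]
        · simp only [DiskMap.blackWords, List.map_reverse, List.sum_reverse]
          rw [h₁.sum_boundary hW hB, h.sum_boundary hW hB, CharTwo.add_self_eq_zero]
        · simp only [DiskMap.blackWords]
          rw [h₁.sum_cycleWord_black hB, h.sum_cycleWord_black hB, CharTwo.add_self_eq_zero]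
    refine sum_totalPairing_eq (G.enumerates_white hW) (G.enumerates_black hB) ?_
      (hcycle h) (hcycle h') ?_ ?_
    · intro x z hx hz
      refine totalPairing_eq_of_planar hG (G.enumerates_white hW) (G.enumerates_black hB)
        (fun w => isChain_cycleWord _ _) ?_ hx hz
      rintro (_ | b)
      · exact G.isChain_boundaryEdges_reverse
      · exact G.isChain_cycleWord_black (hB b)
    · have hsum : ∀ (ℓ₁ : Ed → Finset (Fin r)) e,
          (∑ c, colorChain ℓ₁ c) e = ((ℓ₁ e).card : ZMod 2) := by
        intro ℓ₁ e
        simp [colorChain, colorIndicator]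
      funext e
      rw [hsum, hsum, hcard]
    · intro e
      exact sum_colorIndicator_pairs_eq (hcard e)
  · congr 1
    exact List.map_congr_left fun e _ => sum_colorIndicator_pairs_eq (hcard e)

end DiskMap.Weblike

/-! ## State sums -/

instance : Fintype Heading := ⟨{.toWhite, .toBlack}, fun h => by cases h <;> simp⟩

section SumOver

variable {α β : Type*} [Fintype α] [DecidableEq α] [Fintype β] [DecidableEq β]

/-- The sum of `F` over all the functions that agree with `f` off `D`. -/
def sumOver (D : Finset α) (F : (α → β) → ℂ) (f : α → β) : ℂ :=
  ∑ g : α → β with ∀ a, a ∉ D → g a = f a, F g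

theorem sumOver_empty (F : (α → β) → ℂ) (f : α → β) : sumOver ∅ F f = F f := by
  have : (Finset.univ.filter fun g : α → β => ∀ a, a ∉ (∅ : Finset α) → g a = f a) = {f} := by
    ext g
    simp [funext_iff]
  rw [sumOver, this, Finset.sum_singleton]

theorem sumOver_congr {D : Finset α} {F F' : (α → β) → ℂ} {f : α → β}
    (h : ∀ g, (∀ a, a ∉ D → g a = f a) → F g = F' g) : sumOver D F f = sumOver D F' f :=
  Finset.sum_congr rfl fun g hg => h g (by simpa using hg)

theorem sumOver_singleton (a : α) (F : (α → β) → ℂ) (f : α → β) :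
    sumOver {a} F f = ∑ b, F (Function.update f a b) := by
  refine (Finset.sum_nbij' (fun b => Function.update f a b) (fun g => g a) ?_ ?_ ?_ ?_ ?_).symm
  · intro b _
    simp only [Finset.mem_filter, Finset.mem_univ, true_and, Finset.mem_singleton]
    intro c hc
    exact Function.update_of_ne hc _ _
  · simp
  · simp
  · intro g hg
    simp only [Finset.mem_filter, Finset.mem_univ, true_and, Finset.mem_singleton] at hg
    funext c
    by_cases hc : c = a
    · subst hc; simp
    · rw [Function.update_of_ne hc, hg c hc]
  · simp

theorem sumOver_toFinset (l : List α) [∀ a, Decidable (a ∈ l)] (F : (α → β) → ℂ) (f : α → β) :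
    sumOver l.toFinset F f
      = ∑ B : {a // a ∈ l} → β, F (fun a => if h : a ∈ l then B ⟨a, h⟩ else f a) := by
  refine (Finset.sum_nbij' (fun B a => if h : a ∈ l then B ⟨a, h⟩ else f a)
    (fun g a => g a.1) ?_ ?_ ?_ ?_ ?_).symm
  · intro B _
    simp only [Finset.mem_filter, Finset.mem_univ, true_and, List.mem_toFinset]
    intro c hc
    rw [dif_neg hc]
  · simp
  · intro B _
    funext a
    simp [a.2]
  · intro g hg
    simp only [Finset.mem_filter, Finset.mem_univ, true_and, List.mem_toFinset] at hg
    funext c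
    by_cases hc : c ∈ l
    · simp [hc]
    · simp [hc, hg c hc]
  · simp

theorem sumOver_sumOver {D D' : Finset α} (h : Disjoint D D') (F : (α → β) → ℂ) (f : α → β) :
    sumOver D (sumOver D' F) f = sumOver (D ∪ D') F f := by
  simp only [sumOver]
  rw [Finset.sum_sigma']
  -- The intermediate function is recovered from the final one: the second summation does not touch
  -- `D`, and off `D` the value is that of `f`.
  refine Finset.sum_nbij' (fun p => p.2) (fun g => ⟨fun a => if a ∈ D then g a else f a, g⟩)
    ?_ ?_ ?_ ?_ ?_
  · rintro ⟨g, g'⟩ hg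
    simp only [Finset.mem_sigma, Finset.mem_filter, Finset.mem_univ, true_and, Finset.mem_union,
      not_or] at hg ⊢
    intro a ha
    rw [hg.2 a ha.2, hg.1 a ha.1]
  · intro g hg
    simp only [Finset.mem_sigma, Finset.mem_filter, Finset.mem_univ, true_and, Finset.mem_union,
      not_or] at hg ⊢
    refine ⟨fun a ha => if_neg ha, fun a ha => ?_⟩
    split_ifs with hD
    · rfl
    · exact hg a ⟨hD, ha⟩
  · rintro ⟨g, g'⟩ hg
    simp only [Finset.mem_sigma, Finset.mem_filter, Finset.mem_univ, true_and] at hg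
    have : (fun a => if a ∈ D then g' a else f a) = g := by
      funext a
      split_ifs with hD
      · exact hg.2 a (Finset.disjoint_left.1 h hD)
      · exact (hg.1 a hD).symm
    simp only [this]
  · simp
  · simp

end SumOver

/-! ### Half-edges as wires between the vertices and tags. -/

namespace DiskMap.Weblike

variable {n r : ℕ} {Wh Bl Ed : Type*} [Fintype Ed] [DecidableEq Wh] [DecidableEq Bl]
  [DecidableEq Ed] {G : DiskMap n Wh Bl Ed} {W : G.Weblike r}

theorem mem_edgesAfter {σ : Equiv.Perm Ed} {e f : Ed} :
    f ∈ W.edgesAfter σ e ↔ σ.SameCycle e f ∧ f ≠ e ∧ 0 < W.mult f := by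
  have hnd := nodup_cycleWord σ e
  have hmem := mem_cycleWord (σ := σ) (e := e) (f := f)
  rw [cycleWord_eq_append] at hnd hmem
  have hne : e ∉ List.iterate σ (σ e) (Function.minimalPeriod σ e - 1) :=
    fun h => (List.disjoint_of_nodup_append hnd) h (by simp)
  rw [List.mem_append, List.mem_singleton] at hmem
  rw [edgesAfter, List.mem_filter, decide_eq_true_iff, ← and_assoc]
  refine and_congr_left fun _ => ?_
  rw [← hmem]
  constructor
  · intro h
    exact ⟨.inl h, fun he => hne (he ▸ h)⟩
  · rintro ⟨h | h, h'⟩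
    · exact h
    · exact absurd h h'

theorem nodup_edgesAfter (σ : Equiv.Perm Ed) (e : Ed) : (W.edgesAfter σ e).Nodup := by
  have hnd := nodup_cycleWord σ e
  rw [cycleWord_eq_append] at hnd
  exact (List.Nodup.of_append_left hnd).filter _

/-- The word of all the edges around a vertex, for a labeling that is empty outside of `W`. -/
theorem blockWord_edgesAfter_append {ℓ : Ed → Finset (Fin r)} (hℓ : ∀ e, ¬ 0 < W.mult e → ℓ e = ∅)
    (σ : Equiv.Perm Ed) (e : Ed) :
    blockWord ((W.edgesAfter σ e).map ℓ ++ [ℓ e]) = blockWord ((cycleWord σ e).map ℓ) := by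
  rw [cycleWord_eq_append, List.map_append, blockWord_append, blockWord_append, edgesAfter,
    blockWord_map_filter ℓ (fun f => 0 < W.mult f) hℓ]
  rfl

namespace Tagging

variable (T : W.Tagging)

/-- The half-edges entering a vertex or tag. -/
def Reads : WebPiece Wh Bl Ed → Ed × Heading → Prop
  | .white w, (e, .toWhite) => G.white e = w ∧ 0 < W.mult e ∧ ¬ (T.kind e).LeavesWhite
  | .white _, (_, .toBlack) => False
  | .black b, (e, .toBlack) => e = T.blackIn b
  | .black _, (_, .toWhite) => False
  | .tag e', (e, _) => e = e' ∧ ∃ s, T.kind e = .pair s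

/-- The half-edges leaving a vertex or tag. -/
def Writes : WebPiece Wh Bl Ed → Ed × Heading → Prop
  | .white w, (e, .toBlack) => e = T.whiteOut w
  | .white _, (_, .toWhite) => False
  | .black b, (e, .toWhite) => G.black e = Sum.inl b ∧ 0 < W.mult e ∧ ¬ (T.kind e).EntersBlack
  | .black _, (_, .toBlack) => False
  | .tag e', (e, _) => e = e' ∧ ∃ s, T.kind e = .source s

/-- The vertices and tags of the tagged web. -/
def InWeb : WebPiece Wh Bl Ed → Prop
  | .white _ => True
  | .black _ => True
  | .tag e => 0 < W.mult e ∧ (T.kind e).Tagged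

theorem IsSchedule.mem_iff {T : W.Tagging} {L : List (WebPiece Wh Bl Ed)} (hL : T.IsSchedule L)
    (p : WebPiece Wh Bl Ed) : p ∈ L ↔ T.InWeb p := by
  rcases p with w | b | e
  · simp [InWeb, hL.white_mem]
  · simp [InWeb, hL.black_mem]
  · exact hL.tag_mem e

theorem leavesWhite_whiteOut (w : Wh) : (T.kind (T.whiteOut w)).LeavesWhite :=
  (T.leavesWhite_iff _ (T.mult_whiteOut w)).2 (by rw [T.white_whiteOut])

theorem entersBlack_blackIn (b : Bl) : (T.kind (T.blackIn b)).EntersBlack :=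
  (T.entersBlack_iff _ b (T.mult_blackIn b) (T.black_blackIn b)).2 rfl

theorem whiteOut_eq_iff {e : Ed} {w : Wh} :
    e = T.whiteOut w ↔ G.white e = w ∧ 0 < W.mult e ∧ (T.kind e).LeavesWhite := by
  constructor
  · rintro rfl
    exact ⟨T.white_whiteOut w, T.mult_whiteOut w, T.leavesWhite_whiteOut w⟩
  · rintro ⟨rfl, h1, h2⟩
    exact (T.leavesWhite_iff e h1).1 h2

theorem blackIn_eq_iff {e : Ed} {b : Bl} :
    e = T.blackIn b ↔ G.black e = Sum.inl b ∧ 0 < W.mult e ∧ (T.kind e).EntersBlack := by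
  constructor
  · rintro rfl
    exact ⟨T.black_blackIn b, T.mult_blackIn b, T.entersBlack_blackIn b⟩
  · rintro ⟨h0, h1, h2⟩
    exact (T.entersBlack_iff e b h1 h0).1 h2

theorem mem_edgesAfter_whiteOut {w : Wh} {f : Ed} :
    f ∈ W.edgesAfter G.rotWhite (T.whiteOut w)
      ↔ G.white f = w ∧ 0 < W.mult f ∧ ¬ (T.kind f).LeavesWhite := by
  rw [mem_edgesAfter, G.sameCycle_rotWhite, T.white_whiteOut, ne_eq, whiteOut_eq_iff, eq_comm]
  tauto

theorem mem_edgesAfter_blackIn {b : Bl} {f : Ed} :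
    f ∈ W.edgesAfter G.rotBlack (T.blackIn b)
      ↔ G.black f = Sum.inl b ∧ 0 < W.mult f ∧ ¬ (T.kind f).EntersBlack := by
  rw [mem_edgesAfter, G.sameCycle_rotBlack, T.black_blackIn, ne_eq, blackIn_eq_iff, eq_comm]
  tauto

variable {T}

/-- Through this the order of a schedule and the absence of oriented cycles control when a tensor is
produced and when it is consumed. -/
theorem arrow_of_writes_reads {p q : WebPiece Wh Bl Ed} {a : Ed × Heading} (hp : T.InWeb p)
    (hw : T.Writes p a) (hr : T.Reads q a) : W.Arrow T.kind p q := by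
  rcases a with ⟨e, _ | _⟩
  · rcases p with w | b | e₁
    · exact hw.elim
    · obtain ⟨hb, hm, hk⟩ := hw
      rcases q with w' | b' | e₂
      · obtain ⟨rfl, -, hk'⟩ := hr
        refine .toWhite e b hm ?_ hb
        cases hkind : T.kind e <;> simp_all [EdgeKind.LeavesWhite, EdgeKind.EntersBlack]
      · exact hr.elim
      · obtain ⟨rfl, s, hs⟩ := hr
        exact .pairBlack e s b hm hs hb
    · obtain ⟨rfl, s, hs⟩ := hw
      rcases q with w' | b' | e₂
      · obtain ⟨rfl, -, -⟩ := hr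
        exact .sourceWhite e s hp.1 hs
      · exact hr.elim
      · obtain ⟨rfl, s', hs'⟩ := hr
        rw [hs] at hs'; cases hs'
  · rcases p with w | b | e₁
    · obtain ⟨rfl, hm, hk⟩ := T.whiteOut_eq_iff.1 hw
      rcases q with w' | b' | e₂
      · exact hr.elim
      · obtain ⟨hb, -, hk'⟩ := T.blackIn_eq_iff.1 hr
        refine .toBlack e b' hm ?_ hb
        cases hkind : T.kind e <;> simp_all [EdgeKind.LeavesWhite, EdgeKind.EntersBlack]
      · obtain ⟨rfl, s, hs⟩ := hr
        exact .pairWhite e s hm hs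
    · exact hw.elim
    · obtain ⟨rfl, s, hs⟩ := hw
      rcases q with w' | b' | e₂
      · exact hr.elim
      · obtain ⟨hb, -, -⟩ := T.blackIn_eq_iff.1 hr
        exact .sourceBlack e s b' hp.1 hs hb
      · obtain ⟨rfl, s', hs'⟩ := hr
        rw [hs] at hs'; cases hs'

/-- No tensor is consumed twice, which makes the composite linear in each input. -/
theorem reads_unique {p q : WebPiece Wh Bl Ed} {a : Ed × Heading} (hp : T.Reads p a)
    (hq : T.Reads q a) : p = q := by
  rcases a with ⟨e, _ | _⟩ <;> rcases p with w | b | e₁ <;> rcases q with w' | b' | e₂ <;>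
    first | exact hp.elim | exact hq.elim | skip
  · rw [← hp.1, ← hq.1]
  · obtain ⟨-, s, hs⟩ := hq
    exact absurd hp.2.2 (by simp [hs, EdgeKind.LeavesWhite])
  · obtain ⟨-, s, hs⟩ := hp
    exact absurd hq.2.2 (by simp [hs, EdgeKind.LeavesWhite])
  · rw [← hp.1, ← hq.1]
  · have h1 := (T.blackIn_eq_iff.1 hp).1
    rw [(T.blackIn_eq_iff.1 hq).1] at h1
    rw [Sum.inl_injective h1]
  · obtain ⟨-, s, hs⟩ := hq
    exact absurd (T.blackIn_eq_iff.1 hp).2.2 (by simp [hs, EdgeKind.EntersBlack])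
  · obtain ⟨-, s, hs⟩ := hp
    exact absurd (T.blackIn_eq_iff.1 hq).2.2 (by simp [hs, EdgeKind.EntersBlack])
  · rw [← hp.1, ← hq.1]

/-- The label sums of different pieces therefore run over disjoint sets of half-edges. -/
theorem writes_unique {p q : WebPiece Wh Bl Ed} {a : Ed × Heading} (hp : T.Writes p a)
    (hq : T.Writes q a) : p = q := by
  rcases a with ⟨e, _ | _⟩ <;> rcases p with w | b | e₁ <;> rcases q with w' | b' | e₂ <;>
    first | exact hp.elim | exact hq.elim | skip
  · have h1 := hp.1
    rw [hq.1] at h1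
    rw [Sum.inl_injective h1]
  · obtain ⟨-, s, hs⟩ := hq
    exact absurd hp.2.2 (by simp [hs, EdgeKind.EntersBlack])
  · obtain ⟨-, s, hs⟩ := hp
    exact absurd hq.2.2 (by simp [hs, EdgeKind.EntersBlack])
  · rw [← hp.1, ← hq.1]
  · rw [← (T.whiteOut_eq_iff.1 hp).1, ← (T.whiteOut_eq_iff.1 hq).1]
  · obtain ⟨-, s, hs⟩ := hq
    exact absurd (T.whiteOut_eq_iff.1 hp).2.2 (by simp [hs, EdgeKind.LeavesWhite])
  · obtain ⟨-, s, hs⟩ := hp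
    exact absurd (T.whiteOut_eq_iff.1 hq).2.2 (by simp [hs, EdgeKind.LeavesWhite])
  · rw [← hp.1, ← hq.1]

/-- The half-edges of the tagged web. -/
def Used (T : W.Tagging) : Ed × Heading → Prop
  | (e, .toWhite) => 0 < W.mult e ∧ T.kind e ≠ .toBlack
  | (e, .toBlack) => 0 < W.mult e ∧ T.kind e ≠ .toWhite

theorem used_of_writes {p : WebPiece Wh Bl Ed} {a : Ed × Heading} (hp : T.InWeb p)
    (h : T.Writes p a) : T.Used a := by
  rcases a with ⟨e, _ | _⟩ <;> rcases p with w | b | e₁ <;> first | exact h.elim | skip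
  · exact ⟨h.2.1, fun hk => h.2.2 (by simp [hk, EdgeKind.EntersBlack])⟩
  · obtain ⟨rfl, s, hs⟩ := h
    exact ⟨hp.1, by simp [hs]⟩
  · obtain ⟨-, hm, hk⟩ := T.whiteOut_eq_iff.1 h
    exact ⟨hm, fun hk' => by simp [hk', EdgeKind.LeavesWhite] at hk⟩
  · obtain ⟨rfl, s, hs⟩ := h
    exact ⟨hp.1, by simp [hs]⟩

/-- Every half-edge of the tagged web enters some vertex or tag. -/
theorem exists_reads {a : Ed × Heading} (h : T.Used a) : ∃ q, T.InWeb q ∧ T.Reads q a := by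
  rcases a with ⟨e, _ | _⟩ <;> obtain ⟨hm, hk⟩ := h
  · cases hkind : T.kind e with
    | toBlack => exact absurd hkind hk
    | toWhite =>
      exact ⟨.white (G.white e), trivial, rfl, hm, by simp [hkind, EdgeKind.LeavesWhite]⟩
    | pair s => exact ⟨.tag e, ⟨hm, by simp [hkind, EdgeKind.Tagged]⟩, rfl, s, hkind⟩
    | source s =>
      exact ⟨.white (G.white e), trivial, rfl, hm, by simp [hkind, EdgeKind.LeavesWhite]⟩
  · have enters : (T.kind e).EntersBlack → ∃ q, T.InWeb q ∧ T.Reads q (e, .toBlack) := by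
      intro he
      cases hb : G.black e with
      | inl b => exact ⟨.black b, trivial, T.blackIn_eq_iff.2 ⟨hb, hm, he⟩⟩
      | inr i => exact absurd he (T.boundary_source e i hm hb)
    cases hkind : T.kind e with
    | toWhite => exact absurd hkind hk
    | toBlack => exact enters (by simp [hkind, EdgeKind.EntersBlack])
    | pair s => exact ⟨.tag e, ⟨hm, by simp [hkind, EdgeKind.Tagged]⟩, rfl, s, hkind⟩
    | source s => exact enters (by simp [hkind, EdgeKind.EntersBlack])

theorem used_of_reads {q : WebPiece Wh Bl Ed} {a : Ed × Heading} (hq : T.InWeb q)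
    (h : T.Reads q a) : T.Used a := by
  rcases a with ⟨e, _ | _⟩ <;> rcases q with w | b | e₁ <;> first | exact h.elim | skip
  · exact ⟨h.2.1, fun hk => h.2.2 (by simp [hk, EdgeKind.LeavesWhite])⟩
  · obtain ⟨rfl, s, hs⟩ := h
    exact ⟨hq.1, by simp [hs]⟩
  · obtain ⟨-, hm, hk⟩ := T.blackIn_eq_iff.1 h
    exact ⟨hm, fun hk' => by simp [hk', EdgeKind.EntersBlack] at hk⟩
  · obtain ⟨rfl, s, hs⟩ := h
    exact ⟨hq.1, by simp [hs]⟩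

/-- A half-edge of the tagged web leaves some vertex or tag, unless it starts at the boundary. -/
theorem exists_writes_or_boundary {a : Ed × Heading} (h : T.Used a) :
    (∃ q, T.InWeb q ∧ T.Writes q a) ∨ a.2 = .toWhite ∧ ∃ i, G.black a.1 = Sum.inr i := by
  rcases a with ⟨e, _ | _⟩ <;> obtain ⟨hm, hk⟩ := h
  · have leaves : ¬ (T.kind e).EntersBlack → (∃ q, T.InWeb q ∧ T.Writes q (e, .toWhite)) ∨
        Heading.toWhite = .toWhite ∧ ∃ i, G.black e = Sum.inr i := by
      intro he
      cases hb : G.black e with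
      | inl b => exact .inl ⟨.black b, trivial, hb, hm, he⟩
      | inr i => exact .inr ⟨rfl, i, rfl⟩
    cases hkind : T.kind e with
    | toBlack => exact absurd hkind hk
    | toWhite => exact leaves (by simp [hkind, EdgeKind.EntersBlack])
    | pair s => exact leaves (by simp [hkind, EdgeKind.EntersBlack])
    | source s => exact .inl ⟨.tag e, ⟨hm, by simp [hkind, EdgeKind.Tagged]⟩, rfl, s, hkind⟩
  · have leaves : (T.kind e).LeavesWhite → ∃ q, T.InWeb q ∧ T.Writes q (e, .toBlack) :=
      fun he => ⟨.white (G.white e), trivial, T.whiteOut_eq_iff.2 ⟨rfl, hm, he⟩⟩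
    cases hkind : T.kind e with
    | toWhite => exact absurd hkind hk
    | toBlack => exact .inl (leaves (by simp [hkind, EdgeKind.LeavesWhite]))
    | pair s => exact .inl (leaves (by simp [hkind, EdgeKind.LeavesWhite]))
    | source s => exact .inl ⟨.tag e, ⟨hm, by simp [hkind, EdgeKind.Tagged]⟩, rfl, s, hkind⟩

end Tagging

end DiskMap.Weblike

namespace DiskMap.Weblike

variable {n r : ℕ} {Wh Bl Ed : Type*} [Fintype Ed] [DecidableEq Wh] [DecidableEq Bl]
  [DecidableEq Ed] {G : DiskMap n Wh Bl Ed} {W : G.Weblike r}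

/-! ## Expansion of the evaluation -/

section Represents

variable {U : Type*} [AddCommGroup U] [Module ℂ U]

/-- The functional `k` is multilinear in the tensors on the half-edges in `R`, and its values on
basis tensors are given by `K`. -/
def Represents (E : Module.Basis (Fin r) ℂ U) (R : Finset (Ed × Heading))
    (k : (Ed × Heading → ExteriorAlgebra ℂ U) → ℂ)
    (K : (Ed × Heading → Finset (Fin r)) → ℂ) : Prop :=
  ∀ (x : Ed × Heading → ExteriorAlgebra ℂ U) (s : Ed × Heading → ℂ)
    (β : Ed × Heading → Finset (Fin r)),
    (∀ a ∈ R, x a = s a • E.ExteriorAlgebra (β a)) → k x = (∏ a ∈ R, s a) * K β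

/-- The coefficient with which the shuffle of `E_S` contributes to the labels on `outs`. -/
def shuffleWeight (W : G.Weblike r) (outs : List (Ed × Heading)) (S : Finset (Fin r))
    (β : Ed × Heading → Finset (Fin r)) : ℤ :=
  if ∀ a ∈ outs, (β a).card = W.arcMult a then shuffleCoeff S (outs.map β) else 0

/-- A shuffle of one basis vector overwrites `outs` with basis vectors, so the continuation can be
evaluated term by term. Only the scalars off `outs` survive, besides that of the shuffled tensor. -/
theorem Represents.apply_shuffleThen {E : Module.Basis (Fin r) ℂ U} {R : Finset (Ed × Heading)}
    {k : (Ed × Heading → ExteriorAlgebra ℂ U) → ℂ} {K : (Ed × Heading → Finset (Fin r)) → ℂ}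
    (hk : Represents E R k K) {outs : List (Ed × Heading)} (hout : outs.toFinset ⊆ R)
    {x : Ed × Heading → ExteriorAlgebra ℂ U} {s : Ed × Heading → ℂ}
    {β : Ed × Heading → Finset (Fin r)}
    (hx : ∀ a ∈ R \ outs.toFinset, x a = s a • E.ExteriorAlgebra (β a)) (c : ℂ)
    (S : Finset (Fin r)) :
    Tagging.shuffleThen W E outs (c • E.ExteriorAlgebra S) k x
      = c * (∏ a ∈ R \ outs.toFinset, s a)
        * sumOver outs.toFinset (fun β' => (shuffleWeight W outs S β' : ℂ) * K β') β := by
  have hrepr : ∀ S', E.ExteriorAlgebra.repr (c • E.ExteriorAlgebra S) S'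
      = if S' = S then c else 0 := by
    intro S'
    by_cases h : S' = S
    · simp [h]
    · simp [h]
  rw [Tagging.shuffleThen]
  simp only [hrepr, ite_mul, zero_mul, Finset.sum_ite_eq', Finset.mem_univ, if_true]
  rw [sumOver_toFinset, mul_assoc, Finset.mul_sum (a := ∏ a ∈ R \ outs.toFinset, s a)]
  congr 1
  refine Finset.sum_congr rfl fun B _ => ?_
  have hcard : (∀ a : {a // a ∈ outs}, (B a).card = W.arcMult a.1) ↔
      ∀ a ∈ outs, (if h : a ∈ outs then B ⟨a, h⟩ else β a).card = W.arcMult a := by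
    constructor
    · intro h a ha
      rw [dif_pos ha]
      exact h ⟨a, ha⟩
    · intro h a
      have := h a.1 a.2
      rwa [dif_pos a.2] at this
  have hmap : outs.attach.map B = outs.map fun a => if h : a ∈ outs then B ⟨a, h⟩ else β a := by
    calc outs.attach.map B
        = outs.attach.map ((fun a => if h : a ∈ outs then B ⟨a, h⟩ else β a) ∘ Subtype.val) :=
          List.map_congr_left fun a _ => by simp [a.2]
      _ = _ := by rw [← List.map_map, List.attach_map_subtype_val]
  rw [shuffleWeight, ← hmap]
  by_cases hc : ∀ a : {a // a ∈ outs}, (B a).card = W.arcMult a.1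
  · rw [if_pos hc, if_pos (hcard.1 hc)]
    -- The newly placed tensors are basis vectors themselves, hence the scalar `1` on `outs`.
    have hk' := hk (fun a => if h : a ∈ outs then E.ExteriorAlgebra (B ⟨a, h⟩) else x a)
      (fun a => if a ∈ outs then 1 else s a) (fun a => if h : a ∈ outs then B ⟨a, h⟩ else β a)
      (by
        intro a ha
        by_cases h : a ∈ outs
        · simp [h]
        · simp [h, hx a (by simp [ha, h])])
    rw [hk', ← Finset.prod_sdiff hout]
    have h1 : ∏ a ∈ outs.toFinset, (if a ∈ outs then (1 : ℂ) else s a) = 1 :=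
      Finset.prod_eq_one fun a ha => if_pos (List.mem_toFinset.1 ha)
    have h2 : ∏ a ∈ R \ outs.toFinset, (if a ∈ outs then (1 : ℂ) else s a)
        = ∏ a ∈ R \ outs.toFinset, s a :=
      Finset.prod_congr rfl fun a ha => if_neg (by simp at ha; exact ha.2)
    rw [h1, h2, mul_one]
    ring
  · rw [if_neg hc, if_neg (mt hcard.2 hc)]
    simp

end Represents

theorem prod_map_smul {A α : Type*} [Ring A] [Algebra ℂ A] (s : α → ℂ) (y : α → A) (l : List α) :
    (l.map fun a => s a • y a).prod = (l.map s).prod • (l.map y).prod := by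
  induction l with
  | nil => simp
  | cons a l ih => simp only [List.map_cons, List.prod_cons, ih, smul_mul_smul_comm]

namespace Tagging

open Classical in
/-- The set of half-edges entering a vertex or tag. -/
noncomputable def readSet (T : W.Tagging) (p : WebPiece Wh Bl Ed) : Finset (Ed × Heading) :=
  Finset.univ.filter (T.Reads p)

open Classical in
/-- The set of half-edges leaving a vertex or tag. -/
noncomputable def writeSet (T : W.Tagging) (p : WebPiece Wh Bl Ed) : Finset (Ed × Heading) :=
  Finset.univ.filter (T.Writes p)

variable {T : W.Tagging}

@[simp] theorem mem_readSet {p : WebPiece Wh Bl Ed} {a : Ed × Heading} :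
    a ∈ T.readSet p ↔ T.Reads p a := by simp [readSet]

@[simp] theorem mem_writeSet {p : WebPiece Wh Bl Ed} {a : Ed × Heading} :
    a ∈ T.writeSet p ↔ T.Writes p a := by simp [writeSet]

/-- The matrix entry of the morphism at a vertex or tag, for a labeling of the half-edges. -/
noncomputable def pieceWeight (T : W.Tagging) :
    WebPiece Wh Bl Ed → (Ed × Heading → Finset (Fin r)) → ℤ
  | .white w, β => wedgeCoeff
      ((W.edgesAfter G.rotWhite (T.whiteOut w)).map fun f => β (f, .toWhite))
      (β (T.whiteOut w, .toBlack))
  | .black b, β => shuffleWeight W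
      ((W.edgesAfter G.rotBlack (T.blackIn b)).map fun f => (f, .toWhite))
      (β (T.blackIn b, .toBlack)) β
  | .tag e, β =>
      match T.kind e with
      | .pair true => wedgeCoeff [β (e, .toWhite), β (e, .toBlack)] Finset.univ
      | .pair false => wedgeCoeff [β (e, .toBlack), β (e, .toWhite)] Finset.univ
      | .source true => shuffleWeight W [(e, .toBlack), (e, .toWhite)] Finset.univ β
      | .source false => shuffleWeight W [(e, .toWhite), (e, .toBlack)] Finset.univ β
      | .toWhite => 1
      | .toBlack => 1

/-- The matrix entry at a vertex or tag depends only on the labels of its half-edges. -/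
theorem pieceWeight_congr {p : WebPiece Wh Bl Ed} {β β' : Ed × Heading → Finset (Fin r)}
    (hr : ∀ a, T.Reads p a → β a = β' a) (hw : ∀ a, T.Writes p a → β a = β' a) :
    T.pieceWeight p β = T.pieceWeight p β' := by
  have hshuffle : ∀ (outs : List (Ed × Heading)) S, (∀ a ∈ outs, β a = β' a) →
      shuffleWeight W outs S β = shuffleWeight W outs S β' := by
    intro outs S h
    rw [shuffleWeight, shuffleWeight, List.map_congr_left h]
    congr 1
    exact propext (forall₂_congr fun a ha => by rw [h a ha])
  rcases p with w | b | e
  · simp only [pieceWeight]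
    rw [hw (T.whiteOut w, .toBlack) rfl]
    congr 1
    refine List.map_congr_left fun f hf => hr _ ?_
    exact T.mem_edgesAfter_whiteOut.1 hf
  · simp only [pieceWeight]
    rw [hr (T.blackIn b, .toBlack) rfl]
    refine hshuffle _ _ fun a ha => ?_
    obtain ⟨f, hf, rfl⟩ := List.mem_map.1 ha
    exact hw _ (T.mem_edgesAfter_blackIn.1 hf)
  · simp only [pieceWeight]
    split
    · rename_i hk
      rw [hr (e, .toWhite) ⟨rfl, _, hk⟩, hr (e, .toBlack) ⟨rfl, _, hk⟩]
    · rename_i hk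
      rw [hr (e, .toWhite) ⟨rfl, _, hk⟩, hr (e, .toBlack) ⟨rfl, _, hk⟩]
    · rename_i hk
      refine hshuffle _ _ fun a ha => hw _ ?_
      simp only [List.mem_cons, List.not_mem_nil, or_false] at ha
      rcases ha with rfl | rfl <;> exact ⟨rfl, _, hk⟩
    · rename_i hk
      refine hshuffle _ _ fun a ha => hw _ ?_
      simp only [List.mem_cons, List.not_mem_nil, or_false] at ha
      rcases ha with rfl | rfl <;> exact ⟨rfl, _, hk⟩
    · rfl
    · rfl

section Expansion

variable {U : Type*} [AddCommGroup U] [Module ℂ U] {E : Module.Basis (Fin r) ℂ U}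

theorem volCoeff_smul_mul_smul (c d : ℂ) (S S' : Finset (Fin r)) :
    volCoeff E ((c • E.ExteriorAlgebra S) * (d • E.ExteriorAlgebra S'))
      = c * d * (wedgeCoeff [S, S'] Finset.univ : ℂ) := by
  rw [volCoeff, smul_mul_smul_comm, map_smul, Finsupp.smul_apply, ← repr_prod_exteriorBasis E]
  simp

/-- Prepending a basic morphism is a matrix multiplication: labels on the written half-edges are
summed out and the read half-edges become inputs. The disjointness hypothesis keeps every scalar
from being counted twice. -/
theorem step_represents {p : WebPiece Wh Bl Ed} {R : Finset (Ed × Heading)}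
    {k : (Ed × Heading → ExteriorAlgebra ℂ U) → ℂ} {K : (Ed × Heading → Finset (Fin r)) → ℂ}
    (hk : Represents E R k K) (hw : T.writeSet p ⊆ R)
    (hr : Disjoint (T.readSet p) (R \ T.writeSet p)) :
    Represents E (T.readSet p ∪ (R \ T.writeSet p)) (T.step E p k)
      (sumOver (T.writeSet p) fun β => (T.pieceWeight p β : ℂ) * K β) := by
  intro x s β hx
  rw [Finset.prod_union hr]
  have hxr : ∀ a, T.Reads p a → x a = s a • E.ExteriorAlgebra (β a) :=
    fun a ha => hx a (Finset.mem_union_left _ (mem_readSet.2 ha))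
  have hxw : ∀ a ∈ R \ T.writeSet p, x a = s a • E.ExteriorAlgebra (β a) :=
    fun a ha => hx a (Finset.mem_union_right _ ha)
  rcases p with w | b | e
  · have hread : ∏ a ∈ T.readSet (.white w), s a
        = ((W.edgesAfter G.rotWhite (T.whiteOut w)).map fun f => s (f, .toWhite)).prod := by
      have h1 : T.readSet (.white w)
          = ((W.edgesAfter G.rotWhite (T.whiteOut w)).map fun f => (f, Heading.toWhite)).toFinset := by
        ext ⟨e, h⟩
        simp only [mem_readSet, List.mem_toFinset, List.mem_map, mem_edgesAfter_whiteOut]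
        cases h
        · simp [Reads]
        · simp [Reads]
      rw [h1, List.prod_toFinset, List.map_map]
      · rfl
      · exact (nodup_edgesAfter _ _).map fun _ _ h => (Prod.ext_iff.1 h).1
    have hwrite : T.writeSet (.white w) = {(T.whiteOut w, .toBlack)} := by
      ext ⟨e, h⟩
      cases h <;> simp [Writes]
    rw [hwrite] at hw hxw ⊢
    rw [hread, sumOver_singleton]
    set l := W.edgesAfter G.rotWhite (T.whiteOut w) with hl
    have hmap : (l.map fun f => x (f, .toWhite))
        = l.map fun f => s (f, .toWhite) • E.ExteriorAlgebra (β (f, .toWhite)) :=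
      List.map_congr_left fun f hf => hxr _ (T.mem_edgesAfter_whiteOut.1 hf)
    -- A wedge of basis vectors is a multiple, possibly zero, of a single `E_S`. In the sum over the
    -- outgoing label only this `S` can contribute.
    obtain ⟨h1, h2⟩ := prod_exteriorBasis_eq_smul E (l.map fun f => β (f, .toWhite))
    set S := (blockWord (l.map fun f => β (f, .toWhite))).toFinset with hS
    have hstep : T.step E (.white w) k x = k (Function.update x (T.whiteOut w, .toBlack)
        ((((l.map fun f => s (f, .toWhite)).prod
          * (wedgeCoeff (l.map fun f => β (f, .toWhite)) S : ℂ))) • E.ExteriorAlgebra S)) := by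
      rw [step, ← hl, hmap, prod_map_smul, mul_smul, ← h1, List.map_map]
      rfl
    rw [hstep, hk _ (Function.update s (T.whiteOut w, .toBlack)
      ((l.map fun f => s (f, .toWhite)).prod
          * (wedgeCoeff (l.map fun f => β (f, .toWhite)) S : ℂ)))
      (Function.update β (T.whiteOut w, .toBlack) S)]
    · rw [← Finset.prod_sdiff hw, Finset.prod_singleton, Function.update_self,
        Finset.sum_eq_single S]
      · have h3 : ∏ a ∈ R \ {(T.whiteOut w, Heading.toBlack)},
            Function.update s (T.whiteOut w, .toBlack) ((l.map fun f => s (f, .toWhite)).prod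
              * (wedgeCoeff (l.map fun f => β (f, .toWhite)) S : ℂ)) a
            = ∏ a ∈ R \ {(T.whiteOut w, Heading.toBlack)}, s a := by
          refine Finset.prod_congr rfl fun a ha => Function.update_of_ne ?_ _ _
          simp only [Finset.mem_sdiff, Finset.mem_singleton] at ha
          exact ha.2
        rw [h3]
        simp only [pieceWeight, ← hl, Function.update_self]
        have h4 : (l.map fun f => Function.update β (T.whiteOut w, .toBlack) S (f, .toWhite))
            = l.map fun f => β (f, .toWhite) :=
          List.map_congr_left fun f _ => Function.update_of_ne (by simp) _ _
        rw [h4]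
        ring
      · intro S' _ hS'
        simp only [pieceWeight, ← hl, Function.update_self]
        have h4 : (l.map fun f => Function.update β (T.whiteOut w, .toBlack) S' (f, .toWhite))
            = l.map fun f => β (f, .toWhite) :=
          List.map_congr_left fun f _ => Function.update_of_ne (by simp) _ _
        rw [h4, h2 S' hS']
        simp
      · simp
    · intro a ha
      by_cases h : a = (T.whiteOut w, .toBlack)
      · subst h; simp
      · simp only [Function.update_of_ne h]
        exact hxw a (by simp [ha, h])
  · have hread : T.readSet (.black b) = {(T.blackIn b, .toBlack)} := by
      ext ⟨e, h⟩
      cases h <;> simp [Reads]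
    have hwrite : T.writeSet (.black b)
        = ((W.edgesAfter G.rotBlack (T.blackIn b)).map fun f => (f, Heading.toWhite)).toFinset := by
      ext ⟨e, h⟩
      simp only [mem_writeSet, List.mem_toFinset, List.mem_map, mem_edgesAfter_blackIn]
      cases h
      · simp [Writes]
      · simp [Writes]
    rw [hwrite] at hw hxw ⊢
    rw [hread, Finset.prod_singleton, step, hxr (T.blackIn b, .toBlack) rfl, hk.apply_shuffleThen hw hxw]
    congr 1
    refine sumOver_congr fun β' hβ' => ?_
    simp only [pieceWeight]
    rw [hβ' (T.blackIn b, .toBlack) (by simp)]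
  · have hread_none : (∀ s, T.kind e ≠ .pair s) → T.readSet (.tag e) = ∅ := by
      intro h
      ext ⟨e', h'⟩
      simp only [mem_readSet, Reads]
      constructor
      · rintro ⟨rfl, s, hs⟩
        exact absurd hs (h s)
      · simp
    have hwrite_none : (∀ s, T.kind e ≠ .source s) → T.writeSet (.tag e) = ∅ := by
      intro h
      ext ⟨e', h'⟩
      simp only [mem_writeSet, Writes]
      constructor
      · rintro ⟨rfl, s, hs⟩
        exact absurd hs (h s)
      · simp
    have hread_pair : ∀ s, T.kind e = .pair s →
        T.readSet (.tag e) = {(e, .toWhite), (e, .toBlack)} := by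
      intro s hs
      ext ⟨e', h'⟩
      simp only [mem_readSet, Reads]
      cases h' <;> simp +contextual [hs]
    have hwrite_source : ∀ s, T.kind e = .source s →
        T.writeSet (.tag e) = {(e, .toWhite), (e, .toBlack)} := by
      intro s hs
      ext ⟨e', h'⟩
      simp only [mem_writeSet, Writes]
      cases h' <;> simp +contextual [hs]
    have hpair : ∀ f : Ed × Heading → ℂ,
        ∏ a ∈ ({(e, .toWhite), (e, .toBlack)} : Finset (Ed × Heading)), f a
        = f (e, .toWhite) * f (e, .toBlack) := fun f => Finset.prod_pair (by simp)
    have hone : E.ExteriorAlgebra (Finset.univ : Finset (Fin r))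
        = (1 : ℂ) • E.ExteriorAlgebra Finset.univ := (one_smul _ _).symm
    cases hkind : T.kind e with
    | toWhite =>
      rw [hwrite_none (by simp [hkind])] at hxw ⊢
      rw [hread_none (by simp [hkind]), sumOver_empty]
      simp only [step, pieceWeight, hkind]
      rw [hk x s β (by simpa using hxw)]
      simp
    | toBlack =>
      rw [hwrite_none (by simp [hkind])] at hxw ⊢
      rw [hread_none (by simp [hkind]), sumOver_empty]
      simp only [step, pieceWeight, hkind]
      rw [hk x s β (by simpa using hxw)]
      simp
    | pair t =>
      have h1 := hxr (e, .toWhite) ⟨rfl, t, hkind⟩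
      have h2 := hxr (e, .toBlack) ⟨rfl, t, hkind⟩
      rw [hwrite_none (by simp [hkind])] at hxw ⊢
      rw [hread_pair t hkind, hpair, sumOver_empty]
      cases t <;> simp only [step, pieceWeight, hkind] <;>
        rw [h1, h2, volCoeff_smul_mul_smul, hk x s β (by simpa using hxw), Finset.sdiff_empty] <;>
        ring
    | source t =>
      rw [hread_none (by simp [hkind]), Finset.prod_empty]
      have hset := hwrite_source t hkind
      cases t
      · have hl : T.writeSet (.tag e) = [(e, Heading.toWhite), (e, Heading.toBlack)].toFinset := by
          rw [hset]; simp
        rw [hl] at hw hxw ⊢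
        simp only [step, pieceWeight, hkind]
        rw [hone, hk.apply_shuffleThen hw hxw]
      · have hl : T.writeSet (.tag e) = [(e, Heading.toBlack), (e, Heading.toWhite)].toFinset := by
          rw [hset, Finset.pair_comm]; simp
        rw [hl] at hw hxw ⊢
        simp only [step, pieceWeight, hkind]
        rw [hone, hk.apply_shuffleThen hw hxw]

/-- The half-edges whose tensors a composition of basic morphisms needs as input. -/
noncomputable def inputs (T : W.Tagging) : List (WebPiece Wh Bl Ed) → Finset (Ed × Heading)
  | [] => ∅
  | p :: L => T.readSet p ∪ (inputs T L \ T.writeSet p)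

/-- The half-edges to which a composition of basic morphisms assigns tensors. -/
noncomputable def outputs (T : W.Tagging) : List (WebPiece Wh Bl Ed) → Finset (Ed × Heading)
  | [] => ∅
  | p :: L => T.writeSet p ∪ outputs T L

theorem mem_outputs {L : List (WebPiece Wh Bl Ed)} {a : Ed × Heading} :
    a ∈ T.outputs L ↔ ∃ p ∈ L, T.Writes p a := by
  induction L with
  | nil => simp [outputs]
  | cons p L ih => simp [outputs, ih]

theorem exists_reads_of_mem_inputs {L : List (WebPiece Wh Bl Ed)} {a : Ed × Heading}
    (h : a ∈ T.inputs L) : ∃ q ∈ L, T.Reads q a := by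
  induction L with
  | nil => simp [inputs] at h
  | cons p L ih =>
    simp only [inputs, Finset.mem_union, mem_readSet, Finset.mem_sdiff] at h
    rcases h with h | ⟨h, -⟩
    · exact ⟨p, by simp, h⟩
    · obtain ⟨q, hq, hqa⟩ := ih h
      exact ⟨q, by simp [hq], hqa⟩

theorem mem_inputs_of_reads {L : List (WebPiece Wh Bl Ed)} {a : Ed × Heading}
    {q : WebPiece Wh Bl Ed} (hq : q ∈ L) (hr : T.Reads q a) (hw : ∀ p ∈ L, ¬ T.Writes p a) :
    a ∈ T.inputs L := by
  induction L with
  | nil => simp at hq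
  | cons p L ih =>
    simp only [inputs, Finset.mem_union, mem_readSet, Finset.mem_sdiff, mem_writeSet]
    rcases List.mem_cons.1 hq with rfl | hq
    · exact .inl hr
    · exact .inr ⟨ih hq fun p hp => hw p (by simp [hp]), hw p (by simp)⟩

/-- A half-edge that is both read and written is no input, because it is written first. -/
theorem not_writes_of_mem_inputs {L : List (WebPiece Wh Bl Ed)} (hweb : ∀ p ∈ L, T.InWeb p)
    (hpw : L.Pairwise fun p q => ¬ W.Arrow T.kind q p) {a : Ed × Heading}
    (h : a ∈ T.inputs L) : ∀ p ∈ L, ¬ T.Writes p a := by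
  induction L with
  | nil => simp
  | cons q L ih =>
    rw [List.pairwise_cons] at hpw
    simp only [inputs, Finset.mem_union, mem_readSet, Finset.mem_sdiff, mem_writeSet] at h
    intro p hp hpa
    have harrow : ∀ q', T.Reads q' a → W.Arrow T.kind p q' :=
      fun q' hq' => arrow_of_writes_reads (hweb p hp) hpa hq'
    rcases List.mem_cons.1 hp with rfl | hp
    · rcases h with h | ⟨-, h⟩
      · exact T.acyclic p (.single (harrow p h))
      · exact h hpa
    · rcases h with h | ⟨h, -⟩
      · exact hpw.1 p hp (harrow q h)
      · exact ih (fun p hp => hweb p (by simp [hp])) hpw.2 h p hp hpa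

/-- The evaluation along a final segment of a schedule is a state sum. -/
theorem foldr_represents {L : List (WebPiece Wh Bl Ed)} (hnd : L.Nodup)
    (hweb : ∀ p ∈ L, T.InWeb p) (hpw : L.Pairwise fun p q => ¬ W.Arrow T.kind q p)
    (hclosed : ∀ p ∈ L, ∀ q, T.InWeb q → W.Arrow T.kind p q → q ∈ L) :
    Represents E (T.inputs L) (L.foldr (T.step E) fun _ => 1)
      (sumOver (T.outputs L) fun β => ((L.map fun p => T.pieceWeight p β).prod : ℂ)) := by
  induction L with
  | nil =>
    intro x s β _
    simp [inputs, outputs, sumOver_empty]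
  | cons p L ih =>
    rw [List.nodup_cons] at hnd
    have hweb' : ∀ q ∈ L, T.InWeb q := fun q hq => hweb q (by simp [hq])
    rw [List.pairwise_cons] at hpw
    -- No arrow runs back to `p`, so the remaining segment still contains all targets of its own
    -- arrows.
    have hclosed' : ∀ q ∈ L, ∀ q', T.InWeb q' → W.Arrow T.kind q q' → q' ∈ L := by
      intro q hq q' hq' harr
      rcases List.mem_cons.1 (hclosed q (by simp [hq]) q' hq' harr) with rfl | h
      · exact absurd harr (hpw.1 q hq)
      · exact h
    have hunique : ∀ a, T.Writes p a → ∀ q ∈ L, ¬ T.Writes q a := by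
      intro a ha q hq hqa
      exact hnd.1 (writes_unique ha hqa ▸ hq)
    -- Everything `p` produces is consumed later: its target lies in the segment, is not `p` by
    -- acyclicity, and the half-edge is not overwritten.
    have hw : T.writeSet p ⊆ T.inputs L := by
      intro a ha
      rw [mem_writeSet] at ha
      obtain ⟨q, hq, hqa⟩ := exists_reads (used_of_writes (hweb p (by simp)) ha)
      have harr := arrow_of_writes_reads (hweb p (by simp)) ha hqa
      rcases List.mem_cons.1 (hclosed p (by simp) q hq harr) with rfl | hqL
      · exact absurd (.single harr) (T.acyclic q)
      · exact mem_inputs_of_reads hqL hqa (hunique a ha)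
    have hr : Disjoint (T.readSet p) (T.inputs L \ T.writeSet p) := by
      rw [Finset.disjoint_left]
      intro a ha ha'
      obtain ⟨q, hq, hqa⟩ := exists_reads_of_mem_inputs (Finset.mem_sdiff.1 ha').1
      exact hnd.1 (reads_unique (mem_readSet.1 ha) hqa ▸ hq)
    have hdisj : Disjoint (T.writeSet p) (T.outputs L) := by
      rw [Finset.disjoint_left]
      intro a ha ha'
      obtain ⟨q, hq, hqa⟩ := mem_outputs.1 ha'
      exact hunique a (mem_writeSet.1 ha) q hq hqa
    have key := step_represents (p := p) (ih hnd.2 hweb' hpw.2 hclosed') hw hr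
    have hsum : (sumOver (T.writeSet p) fun β => (T.pieceWeight p β : ℂ)
          * sumOver (T.outputs L) (fun β => ((L.map fun p => T.pieceWeight p β).prod : ℂ)) β)
        = sumOver (T.outputs (p :: L))
          fun β => (((p :: L).map fun p => T.pieceWeight p β).prod : ℂ) := by
      funext β
      rw [outputs, ← sumOver_sumOver hdisj]
      refine sumOver_congr fun β₁ _ => ?_
      rw [sumOver, sumOver, Finset.mul_sum]
      refine Finset.sum_congr rfl fun β₂ hβ₂ => ?_
      simp only [Finset.mem_filter, Finset.mem_univ, true_and] at hβ₂
      rw [List.map_cons, List.prod_cons, Int.cast_mul]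
      congr 2
      -- Later pieces write neither what `p` reads (by the order) nor what `p` writes (by
      -- uniqueness), so the entry at `p` is constant in the inner sum.
      refine pieceWeight_congr (fun a ha => (hβ₂ a fun ha' => ?_).symm)
        fun a ha => (hβ₂ a fun ha' => ?_).symm
      · obtain ⟨q, hq, hqa⟩ := mem_outputs.1 ha'
        exact hpw.1 q hq (arrow_of_writes_reads (hweb' q hq) hqa ha)
      · obtain ⟨q, hq, hqa⟩ := mem_outputs.1 ha'
        exact hunique a ha q hq hqa
    rw [← hsum]
    exact key

end Expansion

end Tagging

end DiskMap.Weblike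

/-! ## Words of partitions into blocks -/

section Blocks

variable {r : ℕ}

theorem blockWord_perm_sort_iff {l : List (Finset (Fin r))} {S : Finset (Fin r)} :
    (blockWord l).Perm S.sort
      ↔ ∀ c, (l.map (colorIndicator ℕ c)).sum = colorIndicator ℕ c S := by
  rw [List.perm_iff_count]
  simp only [count_blockWord, count_sort]

theorem colorIndicator_compl_add (c : Fin r) (S : Finset (Fin r)) :
    colorIndicator ℕ c Sᶜ + colorIndicator ℕ c S = 1 := by
  by_cases h : c ∈ S <;> simp [colorIndicator, h]

theorem blockWord_pair_perm_iff {A B : Finset (Fin r)} :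
    (blockWord [A, B]).Perm (Finset.univ : Finset (Fin r)).sort ↔ B = Aᶜ := by
  rw [blockWord_perm_sort_iff, Finset.ext_iff]
  refine forall_congr' fun c => ?_
  by_cases hA : c ∈ A <;> by_cases hB : c ∈ B <;> simp [colorIndicator, hA, hB]

theorem wedgeCoeff_of_perm {l : List (Finset (Fin r))} {S : Finset (Fin r)}
    (h : (blockWord l).Perm S.sort) :
    wedgeCoeff l S = (((-1) ^ inversions (blockWord l) : ℤˣ) : ℤ) := by
  rw [wedgeCoeff, if_pos h]
  simp

theorem shuffleCoeff_of_perm {l : List (Finset (Fin r))} {S : Finset (Fin r)}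
    (h : (blockWord l).Perm S.sort) :
    shuffleCoeff S l = (((-1) ^ inversions (blockWord l)
      * (-1) ^ pairProductSum (l.map Finset.card) : ℤˣ) : ℤ) := by
  rw [shuffleCoeff, if_pos h]
  simp

theorem perm_of_wedgeCoeff_ne_zero {l : List (Finset (Fin r))} {S : Finset (Fin r)}
    (h : wedgeCoeff l S ≠ 0) : (blockWord l).Perm S.sort := by
  by_contra h'
  exact h (if_neg h')

theorem perm_of_shuffleCoeff_ne_zero {l : List (Finset (Fin r))} {S : Finset (Fin r)}
    (h : shuffleCoeff S l ≠ 0) : (blockWord l).Perm S.sort := by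
  by_contra h'
  exact h (if_neg h')

end Blocks

namespace DiskMap.Weblike

variable {n r : ℕ} {Wh Bl Ed : Type*} [Fintype Ed] [DecidableEq Wh] [DecidableEq Bl]
  [DecidableEq Ed] {G : DiskMap n Wh Bl Ed} {W : G.Weblike r}

theorem degree_eq_mult (W : G.Weblike r) {e : Ed} {i : Fin n} (h : G.black e = Sum.inr i) :
    W.degree i = W.mult e := by
  have : (Finset.univ.filter fun e => G.black e = Sum.inr i) = {e} := by
    ext f
    simp only [Finset.mem_filter, Finset.mem_univ, true_and, Finset.mem_singleton]
    exact ⟨fun hf => G.boundary_unique f e i hf h, fun hf => hf ▸ h⟩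
  rw [degree, this, Finset.sum_singleton]

theorem shuffleWeight_ne_zero {outs : List (Ed × Heading)} {S : Finset (Fin r)}
    {β : Ed × Heading → Finset (Fin r)} (h : shuffleWeight W outs S β ≠ 0) :
    (∀ a ∈ outs, (β a).card = W.arcMult a) ∧ (blockWord (outs.map β)).Perm S.sort := by
  by_cases hc : ∀ a ∈ outs, (β a).card = W.arcMult a
  · rw [shuffleWeight, if_pos hc] at h
    exact ⟨hc, perm_of_shuffleCoeff_ne_zero h⟩
  · exact absurd (if_neg hc) h

theorem shuffleWeight_of_perm {outs : List (Ed × Heading)} {S : Finset (Fin r)}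
    {β : Ed × Heading → Finset (Fin r)} (hc : ∀ a ∈ outs, (β a).card = W.arcMult a)
    (h : (blockWord (outs.map β)).Perm S.sort) :
    shuffleWeight W outs S β = (((-1) ^ inversions (blockWord (outs.map β))
      * (-1) ^ pairProductSum (outs.map W.arcMult) : ℤˣ) : ℤ) := by
  rw [shuffleWeight, if_pos hc, shuffleCoeff_of_perm h, List.map_map]
  congr 4
  exact List.map_congr_left hc

/-- The blocks after `e` partition the complement of the label of `e` exactly when every colour
occurs once around the vertex. -/
theorem edgesAfter_perm_iff {ℓ : Ed → Finset (Fin r)} (hℓ : ∀ e, ¬ 0 < W.mult e → ℓ e = ∅)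
    (σ : Equiv.Perm Ed) (e : Ed) :
    (blockWord ((W.edgesAfter σ e).map ℓ)).Perm (ℓ e)ᶜ.sort
      ↔ ∀ c, ((cycleWord σ e).map fun f => colorIndicator ℕ c (ℓ f)).sum = 1 := by
  rw [blockWord_perm_sort_iff]
  refine forall_congr' fun c => ?_
  have h := congrArg (List.count c) (blockWord_edgesAfter_append (W := W) hℓ σ e)
  rw [count_blockWord, count_blockWord, List.map_append, List.sum_append, List.map_map,
    List.map_map] at h
  have h' := colorIndicator_compl_add c (ℓ e)
  simp only [List.map_cons, List.map_nil, List.sum_cons, List.sum_nil, add_zero] at h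
  change _ ↔ ((cycleWord σ e).map (colorIndicator ℕ c ∘ ℓ)).sum = 1
  rw [← h, List.map_map]
  omega

theorem biUnion_eq_univ_of_sum {s : Finset Ed} {ℓ : Ed → Finset (Fin r)}
    (h : ∀ c, ∑ e ∈ s, colorIndicator ℕ c (ℓ e) = 1) : s.biUnion ℓ = Finset.univ := by
  rw [Finset.eq_univ_iff_forall]
  intro c
  obtain ⟨e, he, hne⟩ := Finset.exists_ne_zero_of_sum_ne_zero ((h c).trans_ne one_ne_zero)
  rw [Finset.mem_biUnion]
  refine ⟨e, he, ?_⟩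
  by_contra hc
  exact hne (if_neg hc)

theorem sum_card_eq_of_sum {s : Finset Ed} {ℓ : Ed → Finset (Fin r)}
    (h : ∀ c, ∑ e ∈ s, colorIndicator ℕ c (ℓ e) = 1) : ∑ e ∈ s, (ℓ e).card = r := by
  have hcard : ∀ e, (ℓ e).card = ∑ c, colorIndicator ℕ c (ℓ e) := fun e => by
    simp [colorIndicator]
  simp only [hcard]
  rw [Finset.sum_comm]
  simp [h]

theorem IsConsistent.eq_empty {ℓ : Ed → Finset (Fin r)} (h : W.IsConsistent ℓ) (e : Ed)
    (he : ¬ 0 < W.mult e) : ℓ e = ∅ := by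
  rw [← Finset.card_eq_zero, h.card_eq]
  omega

namespace Tagging

/-! ## Labelings of edges and of half-edges -/

/-- The label on a half-edge, for a labeling of the edges. -/
def halfLabel (ℓ : Ed → Finset (Fin r)) : Ed × Heading → Finset (Fin r)
  | (e, .toWhite) => ℓ e
  | (e, .toBlack) => (ℓ e)ᶜ

/-- The labels of the half-edges at the boundary. -/
def boundaryLabel (G : DiskMap n Wh Bl Ed) (S : Fin n → Finset (Fin r)) :
    Ed × Heading → Finset (Fin r)
  | (e, .toWhite) => match G.black e with
      | .inr i => S i
      | .inl _ => ∅
  | (_, .toBlack) => ∅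

theorem boundaryLabel_of_black {S : Fin n → Finset (Fin r)} {e : Ed} {i : Fin n}
    (h : G.black e = Sum.inr i) : boundaryLabel G S (e, .toWhite) = S i := by
  simp only [boundaryLabel, h]

open Classical in
/-- The labeling of the half-edges given by a labeling of the edges. -/
noncomputable def spread (T : W.Tagging) (S : Fin n → Finset (Fin r)) (ℓ : Ed → Finset (Fin r))
    (a : Ed × Heading) : Finset (Fin r) :=
  -- On unused half-edges the labels must be those held fixed in the state sum.
  if T.Used a then halfLabel ℓ a else boundaryLabel G S a

open Classical in
/-- The labeling of the edges given by a labeling of the half-edges. -/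
noncomputable def collect (T : W.Tagging) (β : Ed × Heading → Finset (Fin r)) (e : Ed) :
    Finset (Fin r) :=
  if 0 < W.mult e then (if T.kind e = .toBlack then (β (e, .toBlack))ᶜ else β (e, .toWhite)) else ∅

variable {T : W.Tagging} {S : Fin n → Finset (Fin r)} {ℓ : Ed → Finset (Fin r)}
  {β : Ed × Heading → Finset (Fin r)}

theorem spread_of_used {a : Ed × Heading} (h : T.Used a) : T.spread S ℓ a = halfLabel ℓ a :=
  if_pos h

theorem collect_spread (h : W.IsConsistent ℓ) : T.collect (T.spread S ℓ) = ℓ := by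
  funext e
  rw [collect]
  split_ifs with hm hk
  · have hu : T.Used (e, .toBlack) := ⟨hm, by simp [hk]⟩
    rw [spread_of_used hu, halfLabel, compl_compl]
  · have hu : T.Used (e, .toWhite) := ⟨hm, hk⟩
    rw [spread_of_used hu, halfLabel]
  · exact (h.eq_empty e hm).symm

/-- A half-edge of the web that nothing writes starts at the boundary, where the label is
prescribed. Spread labelings are therefore terms of the state sum. -/
theorem spread_eq_boundaryLabel (hS : ∀ e i, G.black e = Sum.inr i → ℓ e = S i)
    {a : Ed × Heading} (ha : ∀ p, T.InWeb p → ¬ T.Writes p a) :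
    T.spread S ℓ a = boundaryLabel G S a := by
  rw [spread]
  split_ifs with h
  · rcases exists_writes_or_boundary h with ⟨q, hq, hqa⟩ | ⟨h1, i, hi⟩
    · exact absurd hqa (ha q hq)
    · obtain ⟨e, h'⟩ := a
      obtain rfl : h' = .toWhite := h1
      rw [boundaryLabel_of_black hi, halfLabel, hS e i hi]
  · rfl

/-- The term of the state sum given by `β` does not vanish. -/
def Supports (T : W.Tagging) (β : Ed × Heading → Finset (Fin r)) : Prop :=
  ∀ p, T.InWeb p → T.pieceWeight p β ≠ 0

/-- A tag has nonzero coefficient only if its two blocks partition `[r]`. -/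
theorem compl_of_tagged (hβ : T.Supports β) {e : Ed} (hm : 0 < W.mult e) (ht : (T.kind e).Tagged) :
    β (e, .toBlack) = (β (e, .toWhite))ᶜ := by
  have h := hβ (.tag e) ⟨hm, ht⟩
  simp only [pieceWeight] at h
  split at h
  · exact blockWord_pair_perm_iff.1 (perm_of_wedgeCoeff_ne_zero h)
  · rw [blockWord_pair_perm_iff.1 (perm_of_wedgeCoeff_ne_zero h), compl_compl]
  · have h' := (shuffleWeight_ne_zero h).2
    simp only [List.map_cons, List.map_nil] at h'
    rw [blockWord_pair_perm_iff.1 h', compl_compl]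
  · exact blockWord_pair_perm_iff.1 (shuffleWeight_ne_zero h).2
  · rename_i hk; simp [hk, EdgeKind.Tagged] at ht
  · rename_i hk; simp [hk, EdgeKind.Tagged] at ht

theorem eq_halfLabel_collect (hβ : T.Supports β) {a : Ed × Heading} (ha : T.Used a) :
    β a = halfLabel (T.collect β) a := by
  rcases a with ⟨e, _ | _⟩ <;> obtain ⟨hm, hk⟩ := ha
  · simp only [halfLabel, collect, if_pos hm, if_neg hk]
  · simp only [halfLabel, collect, if_pos hm]
    split_ifs with hk'
    · rw [compl_compl]
    · refine compl_of_tagged hβ hm ?_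
      cases hkind : T.kind e <;> simp_all [EdgeKind.Tagged]

theorem collect_eq_empty (e : Ed) (he : ¬ 0 < W.mult e) : T.collect β e = ∅ := if_neg he

/-- The incoming labels partition the outgoing one, which is the complement of the label of the
distinguished edge. With that edge included, each colour occurs once around the vertex. -/
theorem sum_white_collect (hβ : T.Supports β) (w : Wh) (c : Fin r) :
    ∑ e with G.white e = w, colorIndicator ℕ c (T.collect β e) = 1 := by
  have h := perm_of_wedgeCoeff_ne_zero (hβ (.white w) trivial)
  rw [eq_halfLabel_collect hβ (used_of_writes (p := .white w) (a := (T.whiteOut w, .toBlack))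
    trivial rfl), halfLabel,
    List.map_congr_left (g := T.collect β) (fun f hf => eq_halfLabel_collect hβ
      (used_of_reads (q := .white w) (a := (f, .toWhite)) trivial
        (T.mem_edgesAfter_whiteOut.1 hf))),
    edgesAfter_perm_iff (collect_eq_empty)] at h
  rw [← G.sum_cycleWord_white (T.white_whiteOut w), h c]

theorem sum_black_collect (hβ : T.Supports β) (b : Bl) (c : Fin r) :
    ∑ e with G.black e = Sum.inl b, colorIndicator ℕ c (T.collect β e) = 1 := by
  have h := (shuffleWeight_ne_zero (hβ (.black b) trivial)).2
  rw [eq_halfLabel_collect hβ (used_of_reads (q := .black b) (a := (T.blackIn b, .toBlack))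
    trivial rfl), halfLabel,
    List.map_map, List.map_congr_left (f := β ∘ fun f => (f, Heading.toWhite))
      (g := T.collect β) (fun f hf => eq_halfLabel_collect hβ
      (used_of_writes (p := .black b) (a := (f, .toWhite)) trivial
        (T.mem_edgesAfter_blackIn.1 hf))),
    edgesAfter_perm_iff (collect_eq_empty)] at h
  rw [← G.sum_cycleWord_black (T.black_blackIn b), h c]

/-- The tensor heading to white was produced by a shuffle, which prescribes sizes, or was placed at
the boundary, where the size is the degree. -/
theorem card_collect_of_ne (hβ : T.Supports β) (hS : ∀ i, (S i).card = W.degree i)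
    (hoff : ∀ a, (∀ p, T.InWeb p → ¬ T.Writes p a) → β a = boundaryLabel G S a) {e : Ed}
    (hm : 0 < W.mult e) (hk : T.kind e ≠ .toBlack) : (T.collect β e).card = W.mult e := by
  have hu : T.Used (e, .toWhite) := ⟨hm, hk⟩
  have hc : T.collect β e = β (e, .toWhite) := (eq_halfLabel_collect hβ hu).symm
  rw [hc]
  by_cases hw : ∃ p, T.InWeb p ∧ T.Writes p (e, .toWhite)
  · obtain ⟨p, hp, hpe⟩ := hw
    have hne := hβ p hp
    rcases p with w | b | e'
    · exact hpe.elim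
    · exact (shuffleWeight_ne_zero hne).1 (e, .toWhite)
        (List.mem_map.2 ⟨e, T.mem_edgesAfter_blackIn.2 hpe, rfl⟩)
    · obtain ⟨rfl, s, hs⟩ := hpe
      cases s <;> simp only [pieceWeight, hs] at hne <;>
        exact (shuffleWeight_ne_zero hne).1 (e, .toWhite) (by simp)
  · rcases exists_writes_or_boundary hu with h | ⟨-, i, hi⟩
    · exact absurd h hw
    · rw [hoff _ fun p hp hpe => hw ⟨p, hp, hpe⟩, boundaryLabel_of_black hi, hS,
        W.degree_eq_mult hi]

theorem isConsistent_collect (hβ : T.Supports β) (hS : ∀ i, (S i).card = W.degree i)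
    (hoff : ∀ a, (∀ p, T.InWeb p → ¬ T.Writes p a) → β a = boundaryLabel G S a) :
    W.IsConsistent (T.collect β) where
  card_eq e := by
    by_cases hm : 0 < W.mult e
    · by_cases hk : T.kind e = .toBlack
      -- A wedge does not prescribe the size of its result. The size follows from the other edges at
      -- the white vertex, since label sizes and multiplicities both add up to `r` there.
      · have hout : e = T.whiteOut (G.white e) :=
          T.whiteOut_eq_iff.2 ⟨rfl, hm, by simp [hk, EdgeKind.LeavesWhite]⟩
        have h1 := sum_card_eq_of_sum (sum_white_collect hβ (G.white e))
        have h2 := W.sum_white (G.white e)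
        have he : e ∈ Finset.univ.filter fun f => G.white f = G.white e := by simp
        rw [← Finset.add_sum_erase _ _ he] at h1 h2
        have h3 : ∑ f ∈ (Finset.univ.filter fun f => G.white f = G.white e).erase e,
            (T.collect β f).card
            = ∑ f ∈ (Finset.univ.filter fun f => G.white f = G.white e).erase e, W.mult f := by
          refine Finset.sum_congr rfl fun f hf => ?_
          simp only [Finset.mem_erase, Finset.mem_filter, Finset.mem_univ, true_and] at hf
          by_cases hmf : 0 < W.mult f
          · refine card_collect_of_ne hβ hS hoff hmf fun hkf => hf.1 ?_
            rw [hout]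
            exact T.whiteOut_eq_iff.2 ⟨hf.2, hmf, by simp [hkf, EdgeKind.LeavesWhite]⟩
          · rw [collect_eq_empty f hmf, Finset.card_empty]
            omega
        omega
      · exact card_collect_of_ne hβ hS hoff hm hk
    · rw [collect_eq_empty e hm, Finset.card_empty]
      omega
  union_white w := biUnion_eq_univ_of_sum (sum_white_collect hβ w)
  union_black b := biUnion_eq_univ_of_sum (sum_black_collect hβ b)

theorem collect_boundary (hβ : T.Supports β) (hS : ∀ i, (S i).card = W.degree i)
    (hoff : ∀ a, (∀ p, T.InWeb p → ¬ T.Writes p a) → β a = boundaryLabel G S a) {e : Ed}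
    {i : Fin n} (hi : G.black e = Sum.inr i) : T.collect β e = S i := by
  by_cases hm : 0 < W.mult e
  · have hk : T.kind e ≠ .toBlack := fun hk =>
      T.boundary_source e i hm hi (by simp [hk, EdgeKind.EntersBlack])
    have hc : T.collect β e = β (e, .toWhite) :=
      (eq_halfLabel_collect hβ (a := (e, .toWhite)) ⟨hm, hk⟩).symm
    rw [hc, hoff, boundaryLabel_of_black hi]
    rintro (w | b | e') - hp
    · exact hp
    · rw [hp.1] at hi
      cases hi
    · obtain ⟨rfl, s, hs⟩ := hp
      exact T.boundary_source e i hm hi (by simp [hs, EdgeKind.EntersBlack])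
  · rw [collect_eq_empty e hm, eq_comm, ← Finset.card_eq_zero, hS, W.degree_eq_mult hi]
    omega

theorem spread_collect (hβ : T.Supports β)
    (hoff : ∀ a, (∀ p, T.InWeb p → ¬ T.Writes p a) → β a = boundaryLabel G S a) :
    T.spread S (T.collect β) = β := by
  funext a
  by_cases ha : T.Used a
  · rw [spread_of_used ha, eq_halfLabel_collect hβ ha]
  · rw [spread, if_neg ha, hoff a fun p hp hpa => ha (used_of_writes hp hpa)]

/-! ## Signs of the local weights -/

/-- The part of the sign of a tag that does not depend on the labeling. -/
def tagSign (T : W.Tagging) (e : Ed) : ℤˣ :=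
  match T.kind e with
  | .pair true => (-1) ^ (W.mult e * (r - W.mult e))
  | .source true => (-1) ^ pairProductSum [r - W.mult e, W.mult e]
  | .source false => (-1) ^ (W.mult e * (r - W.mult e))
      * (-1) ^ pairProductSum [W.mult e, r - W.mult e]
  | _ => 1

/-- The part of the sign of an interior black vertex that does not depend on the labeling. -/
noncomputable def blackSign (T : W.Tagging) (b : Bl) : ℤˣ :=
  (-1) ^ pairProductSum (((W.edgesAfter G.rotBlack (T.blackIn b)).map
    fun f => (f, Heading.toWhite)).map W.arcMult)

/-- The sign of a vertex or tag in the term of the state sum given by a labeling. -/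
noncomputable def pieceSign (T : W.Tagging) (ℓ : Ed → Finset (Fin r)) : WebPiece Wh Bl Ed → ℤˣ
  | .white w => (-1) ^ inversions (blockWord ((cycleWord G.rotWhite (T.whiteOut w)).map ℓ))
      * (-1) ^ complInversions (ℓ (T.whiteOut w))
  | .black b => (-1) ^ inversions (blockWord ((cycleWord G.rotBlack (T.blackIn b)).map ℓ))
      * (-1) ^ complInversions (ℓ (T.blackIn b)) * T.blackSign b
  | .tag e => (-1) ^ complInversions (ℓ e) * T.tagSign e

theorem neg_one_pow_compl_swap (A : Finset (Fin r)) :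
    ((-1) ^ inversions (blockWord [A, Aᶜ]) : ℤˣ)
      = (-1) ^ complInversions A * (-1) ^ (A.card * (r - A.card)) := by
  rw [← inversions_compl_swap A, pow_add, mul_comm, mul_assoc, Int.units_mul_self, mul_one]

/-- The distinguished edge is put back into the word, at the cost of a correction that depends only
on its label. -/
theorem neg_one_pow_edgesAfter (h : W.IsConsistent ℓ) {σ : Equiv.Perm Ed} {e : Ed}
    (hp : (blockWord ((W.edgesAfter σ e).map ℓ)).Perm (ℓ e)ᶜ.sort) :
    ((-1) ^ inversions (blockWord ((W.edgesAfter σ e).map ℓ)) : ℤˣ)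
      = (-1) ^ inversions (blockWord ((cycleWord σ e).map ℓ)) * (-1) ^ complInversions (ℓ e) := by
  rw [← blockWord_edgesAfter_append (W := W) h.eq_empty, inversions_append_block hp, pow_add,
    mul_assoc, Int.units_mul_self, mul_one]

theorem card_halfLabel (h : W.IsConsistent ℓ) (a : Ed × Heading) :
    (halfLabel ℓ a).card = W.arcMult a := by
  rcases a with ⟨e, _ | _⟩
  · exact h.card_eq e
  · rw [halfLabel, Finset.card_compl, h.card_eq, Fintype.card_fin]
    rfl

/-- Consistency supplies the partition at each vertex and tag, so no entry vanishes. Each sign then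
separates into a full word, a correction at one edge and a part fixed by the multiplicities. -/
theorem pieceWeight_spread (h : W.IsConsistent ℓ) {p : WebPiece Wh Bl Ed} (hp : T.InWeb p) :
    T.pieceWeight p (T.spread S ℓ) = (T.pieceSign ℓ p : ℤ) := by
  have hread : ∀ a, T.Reads p a → T.spread S ℓ a = halfLabel ℓ a :=
    fun a ha => spread_of_used (used_of_reads hp ha)
  have hwrite : ∀ a, T.Writes p a → T.spread S ℓ a = halfLabel ℓ a :=
    fun a ha => spread_of_used (used_of_writes hp ha)
  rw [pieceWeight_congr hread hwrite]
  rcases p with w | b | e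
  · have hperm : (blockWord ((W.edgesAfter G.rotWhite (T.whiteOut w)).map ℓ)).Perm
        (ℓ (T.whiteOut w))ᶜ.sort := by
      rw [edgesAfter_perm_iff h.eq_empty]
      intro c
      rw [G.sum_cycleWord_white (T.white_whiteOut w), h.sum_white]
    simp only [pieceWeight, pieceSign, halfLabel]
    rw [wedgeCoeff_of_perm hperm, neg_one_pow_edgesAfter h hperm]
  · have hperm : (blockWord ((W.edgesAfter G.rotBlack (T.blackIn b)).map ℓ)).Perm
        (ℓ (T.blackIn b))ᶜ.sort := by
      rw [edgesAfter_perm_iff h.eq_empty]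
      intro c
      rw [G.sum_cycleWord_black (T.black_blackIn b), h.sum_black]
    have hmap : ((W.edgesAfter G.rotBlack (T.blackIn b)).map fun f => (f, Heading.toWhite)).map
        (halfLabel ℓ) = (W.edgesAfter G.rotBlack (T.blackIn b)).map ℓ := by
      rw [List.map_map]
      rfl
    simp only [pieceWeight, pieceSign]
    rw [shuffleWeight_of_perm (fun a _ => card_halfLabel h a) (by rw [hmap]; exact hperm), hmap,
      neg_one_pow_edgesAfter h hperm, blackSign]
  · have h1 : (blockWord [ℓ e, (ℓ e)ᶜ]).Perm (Finset.univ : Finset (Fin r)).sort :=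
      blockWord_pair_perm_iff.2 rfl
    have h2 : (blockWord [(ℓ e)ᶜ, ℓ e]).Perm (Finset.univ : Finset (Fin r)).sort :=
      blockWord_pair_perm_iff.2 (compl_compl _).symm
    obtain ⟨hm, ht⟩ := hp
    cases hk : T.kind e with
    | toWhite => simp [hk, EdgeKind.Tagged] at ht
    | toBlack => simp [hk, EdgeKind.Tagged] at ht
    | pair s =>
      cases s <;> simp only [pieceWeight, pieceSign, tagSign, hk, halfLabel]
      · rw [wedgeCoeff_of_perm h2, mul_one, complInversions]
      · rw [wedgeCoeff_of_perm h1, neg_one_pow_compl_swap, h.card_eq]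
    | source s =>
      cases s <;> simp only [pieceWeight, pieceSign, tagSign, hk]
      · rw [shuffleWeight_of_perm (outs := [(e, .toWhite), (e, .toBlack)])
          (fun a _ => card_halfLabel h a) h1]
        change (((-1) ^ inversions (blockWord [ℓ e, (ℓ e)ᶜ]) * _ : ℤˣ) : ℤ) = _
        rw [neg_one_pow_compl_swap, h.card_eq, mul_assoc]
        rfl
      · rw [shuffleWeight_of_perm (outs := [(e, .toBlack), (e, .toWhite)])
          (fun a _ => card_halfLabel h a) h2]
        rfl

/-! ### The global sign and the sum over consistent labelings. -/

variable [Fintype Wh] [Fintype Bl]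

open Classical in
theorem IsSchedule.prod_map {M : Type*} [CommMonoid M] {L : List (WebPiece Wh Bl Ed)}
    (hL : T.IsSchedule L) (f : WebPiece Wh Bl Ed → M) :
    (L.map f).prod = (∏ w, f (.white w)) * (∏ b, f (.black b))
      * ∏ e, if 0 < W.mult e ∧ (T.kind e).Tagged then f (.tag e) else 1 := by
  have hperm : L.Perm (((Finset.univ : Finset Wh).toList.map .white
      ++ (Finset.univ : Finset Bl).toList.map .black)
      ++ (Finset.univ.filter fun e => 0 < W.mult e ∧ (T.kind e).Tagged).toList.map .tag) := by
    rw [List.perm_ext_iff_of_nodup hL.nodup]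
    · rintro (w | b | e)
      · simp [hL.white_mem]
      · simp [hL.black_mem]
      · simp [hL.tag_mem]
    · refine List.Nodup.append (List.Nodup.append ?_ ?_ ?_) ?_ ?_
      · exact (Finset.nodup_toList _).map fun _ _ h => by cases h; rfl
      · exact (Finset.nodup_toList _).map fun _ _ h => by cases h; rfl
      · intro p hp hp'
        simp only [List.mem_map] at hp hp'
        obtain ⟨w, -, rfl⟩ := hp
        obtain ⟨b, -, hb⟩ := hp'
        cases hb
      · exact (Finset.nodup_toList _).map fun _ _ h => by cases h; rfl
      · intro p hp hp'
        simp only [List.mem_append, List.mem_map] at hp hp'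
        obtain ⟨e, -, rfl⟩ := hp'
        rcases hp with ⟨w, -, hw⟩ | ⟨b, -, hb⟩
        · cases hw
        · cases hb
  rw [(hperm.map f).prod_eq, ← Finset.prod_filter]
  simp only [List.map_append, List.prod_append, List.map_map, ← Finset.prod_map_toList]
  rfl

open Classical in
/-- The corrections at the vertices and at the tags cancel along every edge. -/
theorem prod_corrections (T : W.Tagging) (ε : Ed → ℤˣ) :
    (∏ w, ε (T.whiteOut w)) * (∏ b, ε (T.blackIn b))
      * (∏ e, if 0 < W.mult e ∧ (T.kind e).Tagged then ε e else 1) = 1 := by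
  have hwhite : ∏ w, ε (T.whiteOut w)
      = ∏ e, if 0 < W.mult e ∧ (T.kind e).LeavesWhite then ε e else 1 := by
    have himage : (Finset.univ.filter fun e => 0 < W.mult e ∧ (T.kind e).LeavesWhite)
        = Finset.univ.image T.whiteOut := by
      ext e
      simp only [Finset.mem_filter, Finset.mem_univ, true_and, Finset.mem_image]
      constructor
      · rintro ⟨hm, hk⟩
        exact ⟨G.white e, (T.whiteOut_eq_iff.2 ⟨rfl, hm, hk⟩).symm⟩
      · rintro ⟨w, rfl⟩
        exact ⟨T.mult_whiteOut w, T.leavesWhite_whiteOut w⟩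
    rw [← Finset.prod_filter, himage, Finset.prod_image]
    intro w _ w' _ hww
    rw [← T.white_whiteOut w, ← T.white_whiteOut w', hww]
  have hblack : ∏ b, ε (T.blackIn b)
      = ∏ e, if 0 < W.mult e ∧ (T.kind e).EntersBlack then ε e else 1 := by
    have himage : (Finset.univ.filter fun e => 0 < W.mult e ∧ (T.kind e).EntersBlack)
        = Finset.univ.image T.blackIn := by
      ext e
      simp only [Finset.mem_filter, Finset.mem_univ, true_and, Finset.mem_image]
      constructor
      · rintro ⟨hm, hk⟩
        cases hb : G.black e with
        | inl b => exact ⟨b, (T.blackIn_eq_iff.2 ⟨hb, hm, hk⟩).symm⟩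
        | inr i => exact absurd hk (T.boundary_source e i hm hb)
      · rintro ⟨b, rfl⟩
        exact ⟨T.mult_blackIn b, T.entersBlack_blackIn b⟩
    rw [← Finset.prod_filter, himage, Finset.prod_image]
    intro b _ b' _ hbb
    have := T.black_blackIn b
    rw [hbb, T.black_blackIn] at this
    exact (Sum.inl_injective this).symm
  rw [hwhite, hblack, ← Finset.prod_mul_distrib, ← Finset.prod_mul_distrib]
  refine Finset.prod_eq_one fun e _ => ?_
  by_cases hm : 0 < W.mult e
  -- An untagged edge directed to black is distinguished at both ends, a pair tag goes with the
  -- white end only and a source tag with the black end only. Each of these gives two equal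
  -- corrections; an edge directed to white gives none.
  · cases hk : T.kind e <;>
      simp [hm, EdgeKind.LeavesWhite, EdgeKind.EntersBlack, EdgeKind.Tagged, Int.units_mul_self]
  · simp [hm]

/-- The total number of inversions of a labeling around the vertices and along the boundary. -/
noncomputable def totalInversions (T : W.Tagging) (ℓ : Ed → Finset (Fin r)) : ℕ :=
  ∑ w, inversions (blockWord ((cycleWord G.rotWhite (T.whiteOut w)).map ℓ))
    + ∑ b, inversions (blockWord ((cycleWord G.rotBlack (T.blackIn b)).map ℓ))
    + inversions (blockWord (G.boundaryEdges.map ℓ))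

theorem neg_one_pow_totalInversions_congr (hG : G.Planar) {ℓ' : Ed → Finset (Fin r)}
    (h : W.IsConsistent ℓ) (h' : W.IsConsistent ℓ') :
    ((-1) ^ T.totalInversions ℓ : ℤˣ) = (-1) ^ T.totalInversions ℓ' := by
  have hpar := inversionParity_congr hG h h' T.white_whiteOut T.black_blackIn
  have hcast : ∀ ℓ : Ed → Finset (Fin r), (T.totalInversions ℓ : ZMod 2)
      = inversionParity G T.whiteOut T.blackIn ℓ := fun ℓ => by
    simp [totalInversions, inversionParity]
  rw [← hcast, ← hcast, ZMod.natCast_eq_natCast_iff'] at hpar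
  apply Units.ext
  push_cast
  rw [neg_one_pow_eq_pow_mod_two, hpar, ← neg_one_pow_eq_pow_mod_two]

open Classical in
/-- The part of the sign of a tagged web that comes from the tagging. -/
noncomputable def taggingSign (T : W.Tagging) : ℤˣ :=
  (∏ b, T.blackSign b) * ∏ e, if 0 < W.mult e ∧ (T.kind e).Tagged then T.tagSign e else 1

theorem prod_pieceSign {L : List (WebPiece Wh Bl Ed)} (hL : T.IsSchedule L)
    (ℓ : Ed → Finset (Fin r)) :
    (L.map (T.pieceSign ℓ)).prod
      = (-1) ^ inversions (blockWord (G.boundaryEdges.map ℓ))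
        * ((-1) ^ T.totalInversions ℓ * T.taggingSign) := by
  classical
  have hcorr := T.prod_corrections fun e => (-1) ^ complInversions (ℓ e)
  have htag : (∏ e, if 0 < W.mult e ∧ (T.kind e).Tagged then T.pieceSign ℓ (.tag e) else 1)
      = (∏ e, if 0 < W.mult e ∧ (T.kind e).Tagged then (-1) ^ complInversions (ℓ e) else 1)
        * ∏ e, if 0 < W.mult e ∧ (T.kind e).Tagged then T.tagSign e else 1 := by
    rw [← Finset.prod_mul_distrib]
    refine Finset.prod_congr rfl fun e _ => ?_
    split_ifs
    · rfl
    · rw [mul_one]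
  rw [hL.prod_map, htag]
  simp only [pieceSign, Finset.prod_mul_distrib, taggingSign, totalInversions, pow_add,
    Finset.prod_pow_eq_pow_sum]
  simp only [Finset.prod_pow_eq_pow_sum] at hcorr
  -- The boundary sign `c` is inserted twice: once as the future `labelSign`, once to complete the
  -- total inversions.
  have rearrange : ∀ a a' d d' b t t' c : ℤˣ, d * d' * t = 1 →
      a * d * (a' * d' * b) * (t * t') = c * (a * a' * c * (b * t')) := by
    intro a a' d d' b t t' c h
    calc a * d * (a' * d' * b) * (t * t') = d * d' * t * (a * a' * (b * t')) := by ac_rfl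
      _ = c * c * (a * a' * (b * t')) := by rw [h, Int.units_mul_self]
      _ = c * (a * a' * c * (b * t')) := by ac_rfl
  exact rearrange _ _ _ _ _ _ _ _ hcorr

/-- Boundary vertices without an edge have degree zero, so their sets are empty and do not change
the word. -/
theorem blockWord_boundaryEdges (hS : ∀ i, (S i).card = W.degree i)
    (hℓ : ∀ e i, G.black e = Sum.inr i → ℓ e = S i) :
    blockWord (G.boundaryEdges.map ℓ) = blockWord (List.ofFn S) := by
  rw [DiskMap.boundaryEdges, List.ofFn_eq_map]
  induction List.finRange n with
  | nil => rfl
  | cons i l ih =>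
    rw [List.flatMap_cons, List.map_append, blockWord_append, ih, List.map_cons, blockWord_cons]
    congr 1
    by_cases hi : ∃ e, G.black e = Sum.inr i
    · obtain ⟨e, he⟩ := hi
      have : (Finset.univ.filter fun e => G.black e = Sum.inr i) = {e} := by
        ext f
        simp only [Finset.mem_filter, Finset.mem_univ, true_and, Finset.mem_singleton]
        exact ⟨fun hf => G.boundary_unique f e i hf he, fun hf => hf ▸ he⟩
      simp [this, hℓ e i he]
    · have : (Finset.univ.filter fun e => G.black e = Sum.inr i) = ∅ := by
        rw [Finset.filter_eq_empty_iff]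
        exact fun e _ he => hi ⟨e, he⟩
      have hd : W.degree i = 0 := by rw [degree, this, Finset.sum_empty]
      have hSi : S i = ∅ := by rw [← Finset.card_eq_zero, hS, hd]
      simp [this, hSi]

/-- The evaluation of a tagged web on basis tensors is a sum over the consistent labelings. -/
theorem evaluate_eq_sum {U : Type*} [AddCommGroup U] [Module ℂ U] (E : Module.Basis (Fin r) ℂ U)
    {L : List (WebPiece Wh Bl Ed)} (hL : T.IsSchedule L) (hS : ∀ i, (S i).card = W.degree i)
    [Fintype {ℓ : Ed → Finset (Fin r) //
      W.IsConsistent ℓ ∧ ∀ e i, G.black e = Sum.inr i → ℓ e = S i}] :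
    T.evaluate L E (fun i => E.ExteriorAlgebra (S i))
      = ∑ ℓ : {ℓ : Ed → Finset (Fin r) //
          W.IsConsistent ℓ ∧ ∀ e i, G.black e = Sum.inr i → ℓ e = S i},
          ((L.map (T.pieceSign ℓ.1)).prod : ℂ) := by
  have hprefactor : ∏ i with W.degree i = 0,
      E.ExteriorAlgebra.repr (E.ExteriorAlgebra (S i)) ∅ = 1 := by
    refine Finset.prod_eq_one fun i hi => ?_
    rw [Finset.mem_filter] at hi
    have : S i = ∅ := by rw [← Finset.card_eq_zero, hS, hi.2]
    simp [this]
  have hweb : ∀ p ∈ L, T.InWeb p := fun p hp => (hL.mem_iff p).1 hp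
  have hout : ∀ a, a ∉ T.outputs L ↔ ∀ p, T.InWeb p → ¬ T.Writes p a := by
    intro a
    rw [mem_outputs]
    push Not
    exact forall_congr' fun p => by rw [hL.mem_iff]
  have hrep := foldr_represents (E := E) hL.nodup hweb hL.pairwise
    (fun _ _ q hq _ => (hL.mem_iff q).2 hq)
    (initialTensors G fun i => E.ExteriorAlgebra (S i)) (fun _ => 1) (boundaryLabel G S) (by
      intro a ha
      obtain ⟨q, hq, hqa⟩ := exists_reads_of_mem_inputs ha
      have hnw := not_writes_of_mem_inputs hweb hL.pairwise ha
      rcases exists_writes_or_boundary (used_of_reads (hweb q hq) hqa) with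
        ⟨p, hp, hpa⟩ | ⟨h1, i, hi⟩
      · exact absurd hpa (hnw p ((hL.mem_iff p).2 hp))
      · obtain ⟨e, h'⟩ := a
        obtain rfl : h' = .toWhite := h1
        change G.black e = _ at hi
        rw [boundaryLabel_of_black hi, one_smul]
        simp only [initialTensors, hi])
  rw [evaluate, hprefactor, one_mul, hrep, Finset.prod_const_one, one_mul, sumOver]
  symm
  -- Consistent labelings embed in the half-edge labelings through `spread`. A term outside the
  -- image vanishes, because a nonzero term is the spread of its own `collect`.
  refine Finset.sum_of_injOn (fun ℓ => T.spread S ℓ.1) ?_ ?_ ?_ ?_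
  · intro ℓ _ ℓ' _ hll
    apply Subtype.ext
    rw [← collect_spread (T := T) (S := S) ℓ.2.1, ← collect_spread (T := T) (S := S) ℓ'.2.1]
    exact congrArg T.collect hll
  · intro ℓ _
    simp only [Finset.coe_filter, Finset.mem_univ, true_and, Set.mem_ofPred_eq]
    intro a ha
    exact spread_eq_boundaryLabel ℓ.2.2 ((hout a).1 ha)
  · intro β hβ hnot
    simp only [Finset.mem_filter, Finset.mem_univ, true_and] at hβ
    by_contra hne
    have hsupp : T.Supports β := by
      intro p hp h0
      refine hne ?_
      rw [List.prod_eq_zero, Int.cast_zero]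
      exact List.mem_map.2 ⟨p, (hL.mem_iff p).2 hp, h0⟩
    have hoff : ∀ a, (∀ p, T.InWeb p → ¬ T.Writes p a) → β a = boundaryLabel G S a :=
      fun a ha => hβ a ((hout a).2 ha)
    exact hnot ⟨⟨T.collect β, isConsistent_collect hsupp hS hoff,
      fun e i hi => collect_boundary hsupp hS hoff hi⟩, by simp, spread_collect hsupp hoff⟩
  · intro ℓ _
    have : L.map (fun p => T.pieceWeight p (T.spread S ℓ.1))
        = (L.map (T.pieceSign ℓ.1)).map fun u : ℤˣ => (u : ℤ) := by
      rw [List.map_map]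
      exact List.map_congr_left fun p hp => pieceWeight_spread ℓ.2.1 (hweb p hp)
    rw [this, ← Units.coeHom_apply, map_list_prod]
    rfl

end Tagging

end DiskMap.Weblike

/-! ### The lemma. -/

theorem lemma5p1 {n r : ℕ} {Wh Bl Ed : Type*} [Fintype Wh] [Fintype Bl] [Fintype Ed]
    [DecidableEq Wh] [DecidableEq Bl] [DecidableEq Ed]
    (G : DiskMap n Wh Bl Ed) (hG : G.Planar) (W : G.Weblike r) (T : W.Tagging) :
    ∃ sgn : ℤˣ, ∀ (U : Type*) [AddCommGroup U] [Module ℂ U] (E : Module.Basis (Fin r) ℂ U)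
      (L : List (WebPiece Wh Bl Ed)), T.IsSchedule L →
      ∀ S : Fin n → Finset (Fin r), W.IsBoundaryLabels S →
        T.evaluate L E (fun i => E.ExteriorAlgebra (S i))
          = ((labelSign S : ℤ) : ℂ) * ((sgn : ℤ) : ℂ) * (W.labelingCount S : ℂ) := by
  classical
  have hsgn : ∃ sgn : ℤˣ, ∀ ℓ, W.IsConsistent ℓ →
      (-1) ^ T.totalInversions ℓ * T.taggingSign = sgn := by
    -- The sign is read off from any one consistent labeling, before a basis, schedule or boundary
    -- is chosen. If there is none, every value is an empty sum and any sign serves.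
    by_cases h : ∃ ℓ₀, W.IsConsistent ℓ₀
    · obtain ⟨ℓ₀, h₀⟩ := h
      exact ⟨_, fun ℓ hℓ => by
        rw [DiskMap.Weblike.Tagging.neg_one_pow_totalInversions_congr hG hℓ h₀]⟩
    · exact ⟨1, fun ℓ hℓ => absurd ⟨ℓ, hℓ⟩ h⟩
  obtain ⟨sgn, hsgn⟩ := hsgn
  refine ⟨sgn, fun U _ _ E L hL S hS => ?_⟩
  rw [DiskMap.Weblike.Tagging.evaluate_eq_sum E hL hS.card_eq, Finset.sum_congr rfl
    (g := fun _ => ((labelSign S : ℤ) : ℂ) * ((sgn : ℤ) : ℂ))]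
  · rw [Finset.sum_const, Finset.card_univ, nsmul_eq_mul, mul_comm,
      DiskMap.Weblike.labelingCount, Nat.card_eq_fintype_card]
  · intro ℓ _
    rw [DiskMap.Weblike.Tagging.prod_pieceSign hL, hsgn ℓ.1 ℓ.2.1,
      DiskMap.Weblike.Tagging.blockWord_boundaryEdges hS.card_eq ℓ.2.2, ← labelSign]
    push_cast
    rfl
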